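/- Let $D=\{0,1,\dots,m-1\}$ with $m\ge 2$, ordered by $0<1<\dots<m-1$. Call $f\colon D\to D$ co-Boolean if its range is $\{0,1\}$. Let $F=\{f_1,\dots,f_k\}$ be a finite set of functions $D\to D$, each of which is co-Boolean or constant. Put $$F^H=\{(d,f_1(d),\dots,f_k(d)) : d\in D\},\qquad F^H_r=\{(f_1(d),\dots,f_k(d)) : d\in D\}.$$ Assume that $F^H_r$ is closed under the coordinatewise minimum, or that it is closed under the coordinatewise maximum (on coordinates with values in $\{0,1\}$ these are conjunction and disjunction, and on constant coordinates they act trivially). Let $(0,a)$ and $(1,b)$ be the elements of $F^H$ with first coordinate $0$ and $1$, and assume $a\preceq b$, i.e. $a[i]\le b[i]$ for every $i\in\{1,\dots,k\}$. Let $\Gamma_F=\{\{(x,f(x)) : x\in D\} : f\in F\}$ be the set of the graphs of the functions in $F$. Then $\operatorname{CSP}(\Gamma_F)$ is in $\mathrm{P}$: there is a Turing machine which, given a conjunction of constraints of the form $R(x,y)$ with $R\in\Gamma_F$ and variables $x,y$ (named by binary numbers), some of the variables being possibly existentially quantified, decides in time polynomial in the length of the input whether there is an assignment of values in $D$ to the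 variables that satisfies all the constraints. -/

import Mathlib

namespace CoBooleanCSP

/-! ### Relations, formulas, constraint satisfaction problems -/

/-- A relation on `D` of some finite arity. -/
structure FinRel (D : Type) where
  arity : ℕ
  tuples : Set (Fin arity → D)

/-- A constraint `R(x₁, …, x_k)` with `R ∈ S`. Variables are named by natural numbers. -/
structure Constraint {D : Type} (S : Set (FinRel D)) where
  rel : S
  args : Fin rel.1.arity → ℕ

/-- An `S`-formula: a conjunction of `S`-constraints, in which the variables listed in `bound` are
existentially quantified (the other variables are free). -/
structure Formula {D : Type} (S : Set (FinRel D)) where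
  bound : List ℕ
  constraints : List (Constraint S)

/-- The interpretation `I` satisfies the constraint `c`. -/
def Constraint.Holds {D : Type} {S : Set (FinRel D)} (c : Constraint S) (I : ℕ → D) : Prop :=
  (fun i => I (c.args i)) ∈ c.rel.1.tuples

/-- A formula is satisfiable if some interpretation of all its variables, free or quantified,
satisfies every constraint. -/
def Formula.Satisfiable {D : Type} {S : Set (FinRel D)} (φ : Formula S) : Prop :=
  ∃ I : ℕ → D, ∀ c ∈ φ.constraints, c.Holds I

/-- The alphabet for writing `S`-formulas: a symbol `∃`, a symbol for each relation of `S`,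
a symbol that starts a variable name, and the two binary digits. It is finite if `S` is finite. -/
inductive Sym {D : Type} (S : Set (FinRel D)) : Type where
  | exist : Sym S
  | rel (R : S) : Sym S
  | var : Sym S
  | bit (b : Bool) : Sym S

/-- A variable is written as the symbol `var` followed by its name in binary. -/
def encodeVar {D : Type} (S : Set (FinRel D)) (x : ℕ) : List (Sym S) :=
  Sym.var :: x.bits.map Sym.bit

/-- A constraint is written as the symbol of its relation followed by its variables. -/
def Constraint.encode {D : Type} {S : Set (FinRel D)} (c : Constraint S) : List (Sym S) :=
  Sym.rel c.rel :: (List.ofFn c.args).flatMap (encodeVar S)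

/-- A formula is written as the list of its quantified variables, each preceded by `∃`, followed
by the list of its constraints. -/
def Formula.encode {D : Type} {S : Set (FinRel D)} (φ : Formula S) : List (Sym S) :=
  φ.bound.flatMap (fun x => Sym.exist :: encodeVar S x) ++
    φ.constraints.flatMap Constraint.encode

open Classical in
/-- The decision problem `p` on instances of type `α`, written as words by `enc`, is solvable in
polynomial time: some Turing machine answers every instance correctly with `true` or `false`,
within a number of steps polynomial in the length of the word that encodes the instance. -/
def SolvableInPolyTime {α Γ : Type} (enc : α → List Γ) (p : α → Prop) : Prop :=
  Nonempty (Turing.TM2ComputableInPolyTime enc Computability.encodeBool fun a => decide (p a))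

/-- `CSP(S)` is in `P`. (The template `S` has to be finite, as a Turing machine has a finite input
alphabet.) -/
def CSPInP {D : Type} (S : Set (FinRel D)) : Prop :=
  SolvableInPolyTime (Formula.encode (S := S)) Formula.Satisfiable

/-! ### Graphs of unary functions and the `H`-normal form -/

/-- The graph `{(x, f x) | x ∈ D}`, as a binary relation. -/
def graph {D : Type} (f : D → D) : FinRel D where
  arity := 2
  tuples := {t | ∃ x, t = ![x, f x]}

/-- The template consisting of the graphs of the functions of `F`. -/
def graphs {D : Type} (F : Set (D → D)) : Set (FinRel D) :=
  graph '' F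

/-- The `H`-normal form `F^H = {(d, f₁ d, …, f_k d) | d ∈ D}` of `F = {f₁, …, f_k}`. -/
def hNormalForm {D : Type} {k : ℕ} (f : Fin k → D → D) : Set (Fin (k + 1) → D) :=
  {t | ∃ d, t = Fin.cons d fun i => f i d}

/-- The proper `H`-normal form `F^H_r = {(f₁ d, …, f_k d) | d ∈ D}` of `F = {f₁, …, f_k}`. -/
def properHNormalForm {D : Type} {k : ℕ} (f : Fin k → D → D) : Set (Fin k → D) :=
  {t | ∃ d, t = fun i => f i d}

/-- The relation `R` is closed under the binary operation `p`, applied coordinatewise. -/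
def ClosedUnder {D : Type} {l : ℕ} (p : D → D → D) (R : Set (Fin l → D)) : Prop :=
  ∀ s ∈ R, ∀ t ∈ R, (fun i => p (s i) (t i)) ∈ R

/-- A unary function on `D = {0, …, n + 1}` is (homogeneous) co-Boolean if its range
is `{0, 1}`. -/
def IsCoBoolean {n : ℕ} (f : Fin (n + 2) → Fin (n + 2)) : Prop :=
  Set.range f = {0, 1}

/-- The unary constant functions. -/
def IsConstant {D : Type} (f : D → D) : Prop :=
  ∃ c, ∀ x, f x = c

end CoBooleanCSP

/-! The template is solved by arc consistency. This works because there is an operation `P` from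
subsets of `D` to `D` with `P (g A) = g (P A)` for all `g` in `F` and all nonempty `A`.

Existence of `P` (`exists_commuting_operation`), for closure under `min`: the row of a point `d` is
`(f₁ d, …, f_k d)`. For nonempty `A` the minimum of the rows of the points of `A` is again a row,
say of `d`, and `P A := d` gives `f_i (P A) = min f_i(A)`. It remains to have `P B = min B` for the
images `B = f_i(A)`. These are subsets of `{0,1}` or singletons, and there `min B` is a legitimate
choice of `d`: the assumption `a ≤ b` says that every `f_i` is monotone on `{0,1}`. The `max` case
is the order dual.

Correctness (`empty_iterate_eq_false_iff`): each variable has a domain, initially `D`. A constraint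
`y = g x` restricts the domain of `x` to the points that `g` sends into the domain of `y`, and then
the domain of `y` to their image. No value of a solution is ever removed. If a whole round changes
nothing and finds no empty domain, then `g` maps the domain of `x` onto that of `y` for every
constraint, so applying `P` to all domains gives a solution.

Complexity (`exec_decideSat`): every round that changes something shrinks the total size of the
domains of the variables in the constraints, so the number of rounds is linear in the input. Domains
are kept as a growing list of restrictions, to be intersected at each lookup; a round lengthens it
by at most the input length. The algorithm is a while program over stacks, and
`Prog.Runs.iterate_step` translates its runs into runs of a `Turing.TM2` machine with the same
number of steps. -/

namespace CoBooleanCSP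

/-! ### While programs over stacks -/

/-- While programs that work on finitely many stacks and an internal state. -/
inductive Prog {K : Type} (Γ : K → Type) (σ : Type) : Type where
  | push (k : K) (f : σ → Γ k) : Prog Γ σ
  | pop (k : K) (f : σ → Option (Γ k) → σ) : Prog Γ σ
  | load (f : σ → σ) : Prog Γ σ
  | seq (p q : Prog Γ σ) : Prog Γ σ
  | ite (c : σ → Bool) (p q : Prog Γ σ) : Prog Γ σ
  | loop (c : σ → Bool) (p : Prog Γ σ) : Prog Γ σ

namespace Prog

variable {K : Type} {Γ : K → Type} {σ : Type}

/-- The program locations of a program. -/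
def Label : Prog Γ σ → Type
  | push _ _ => Unit
  | pop _ _ => Unit
  | load _ => Unit
  | seq p q => Label p ⊕ Label q
  | ite _ p q => Option (Label p ⊕ Label q)
  | loop _ p => Option (Label p)

/-- The location at which a program starts. -/
def start : (p : Prog Γ σ) → p.Label
  | push _ _ => ()
  | pop _ _ => ()
  | load _ => ()
  | seq p _ => Sum.inl p.start
  | ite _ _ _ => none
  | loop _ _ => none

theorem finite_label (p : Prog Γ σ) : Finite p.Label := by
  induction p with
  | push | pop | load => exact inferInstanceAs (Finite Unit)
  | seq p q hp hq => exact inferInstanceAs (Finite (p.Label ⊕ q.Label))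
  | ite c p q hp hq => exact inferInstanceAs (Finite (Option (p.Label ⊕ q.Label)))
  | loop c p hp => exact inferInstanceAs (Finite (Option p.Label))

/-- The stack machine statements that implement a program whose locations are embedded into the
labels by `emb` and which continues with the statement `e`. -/
def code {Λ : Type} : (p : Prog Γ σ) → (p.Label → Λ) → Turing.TM2.Stmt Γ Λ σ → p.Label →
    Turing.TM2.Stmt Γ Λ σ
  | push k f, _, e, _ => .push k f e
  | pop k f, _, e, _ => .pop k f e
  | load f, _, e, _ => .load f e
  | seq p q, emb, e, l =>
    match l with
    | Sum.inl l => code p (fun l => emb (Sum.inl l)) (.goto fun _ => emb (Sum.inr q.start)) l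
    | Sum.inr l => code q (fun l => emb (Sum.inr l)) e l
  | ite c p q, emb, e, l =>
    match l with
    | none => .branch c (.goto fun _ => emb (some (Sum.inl p.start)))
        (.goto fun _ => emb (some (Sum.inr q.start)))
    | some (Sum.inl l) => code p (fun l => emb (some (Sum.inl l))) e l
    | some (Sum.inr l) => code q (fun l => emb (some (Sum.inr l))) e l
  | loop c p, emb, e, l =>
    match l with
    | none => .branch c (.goto fun _ => emb (some p.start)) e
    | some l => code p (fun l => emb (some l)) (.goto fun _ => emb none) l

variable [DecidableEq K]

/-- `Runs p v S v' S' t`: the program `p`, started in the state `v` with stacks `S`, ends in the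
state `v'` with stacks `S'` after `t` steps. -/
inductive Runs : Prog Γ σ → σ → (∀ k, List (Γ k)) → σ → (∀ k, List (Γ k)) → ℕ → Prop where
  | push (k f v S) : Runs (push k f) v S v (Function.update S k (f v :: S k)) 1
  | pop (k f v S) :
    Runs (pop k f) v S (f v (S k).head?) (Function.update S k (S k).tail) 1
  | load (f v S) : Runs (load f) v S (f v) S 1
  | seq {p q v S v₁ S₁ v₂ S₂ s t} : Runs p v S v₁ S₁ s → Runs q v₁ S₁ v₂ S₂ t →
    Runs (seq p q) v S v₂ S₂ (s + t)
  | ite_true {c p q v S v₁ S₁ t} : c v = true → Runs p v S v₁ S₁ t →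
    Runs (ite c p q) v S v₁ S₁ (1 + t)
  | ite_false {c p q v S v₁ S₁ t} : c v = false → Runs q v S v₁ S₁ t →
    Runs (ite c p q) v S v₁ S₁ (1 + t)
  | loop_true {c p v S v₁ S₁ v₂ S₂ s t} : c v = true → Runs p v S v₁ S₁ s →
    Runs (loop c p) v₁ S₁ v₂ S₂ t → Runs (loop c p) v S v₂ S₂ (1 + s + t)
  | loop_false {c p v S} : c v = false → Runs (loop c p) v S v S 1

/-- One machine step executes a statement up to its next jump, so the continuation `e` is already
carried out in the step of the last location. Arbitrary `emb` and `e` let the induction enter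
subprograms. The `flip bind` form is that of `Turing.EvalsTo`. -/
theorem Runs.iterate_step {p : Prog Γ σ} {v v' : σ} {S S' : ∀ k, List (Γ k)} {t : ℕ}
    (h : Runs p v S v' S' t) {Λ : Type} (M : Λ → Turing.TM2.Stmt Γ Λ σ) (emb : p.Label → Λ)
    (e : Turing.TM2.Stmt Γ Λ σ) (hM : ∀ l, M (emb l) = p.code emb e l) :
    (flip bind (Turing.TM2.step M))^[t] (some ⟨some (emb p.start), v, S⟩) =
      some (Turing.TM2.stepAux e v' S') := by
  have bind_step (l : Λ) (v : σ) (S : ∀ k, List (Γ k)) :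
      flip bind (Turing.TM2.step M) (some ⟨some l, v, S⟩) =
        some (Turing.TM2.stepAux (M l) v S) := rfl
  induction h generalizing e with
  | push k f v S => rw [Function.iterate_one, bind_step, hM]; rfl
  | pop k f v S => rw [Function.iterate_one, bind_step, hM]; rfl
  | load f v S => rw [Function.iterate_one, bind_step, hM]; rfl
  | @seq p q v S v₁ S₁ v₂ S₂ s t hp hq ihp ihq =>
    rw [Nat.add_comm, Function.iterate_add_apply]
    erw [ihp (fun l => emb (Sum.inl l)) (.goto fun _ => emb (Sum.inr q.start))
      (fun l => hM (Sum.inl l))]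
    exact ihq (fun l => emb (Sum.inr l)) e (fun l => hM (Sum.inr l))
  | @ite_true c p q v S v₁ S₁ t hc hp ihp =>
    rw [Nat.add_comm, Function.iterate_add_apply, Function.iterate_one, bind_step, hM]
    simp only [start, code, Turing.TM2.stepAux, hc, cond_true]
    exact ihp (fun l => emb (some (Sum.inl l))) e (fun l => hM (some (Sum.inl l)))
  | @ite_false c p q v S v₁ S₁ t hc hp ihp =>
    rw [Nat.add_comm, Function.iterate_add_apply, Function.iterate_one, bind_step, hM]
    simp only [start, code, Turing.TM2.stepAux, hc, cond_false]
    exact ihp (fun l => emb (some (Sum.inr l))) e (fun l => hM (some (Sum.inr l)))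
  | @loop_true c p v S v₁ S₁ v₂ S₂ s t hc hp hl ihp ihl =>
    rw [show 1 + s + t = t + (s + 1) by omega, Function.iterate_add_apply,
      Function.iterate_add_apply _ s 1, Function.iterate_one, bind_step, hM]
    simp only [start, code, Turing.TM2.stepAux, hc, cond_true]
    erw [ihp (fun l => emb (some l)) (.goto fun _ => emb none) (fun l => hM (some l))]
    exact ihl emb e hM
  | loop_false hc =>
    rw [Function.iterate_one, bind_step, hM]
    simp only [start, code, Turing.TM2.stepAux, hc, cond_false]

/-- The program runs from one configuration to another in at most `t` steps. -/
def Within (p : Prog Γ σ) (v : σ) (S : ∀ k, List (Γ k)) (v' : σ) (S' : ∀ k, List (Γ k))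
    (t : ℕ) : Prop :=
  ∃ s ≤ t, Runs p v S v' S' s

variable {p q : Prog Γ σ} {v v₁ v₂ : σ} {S S₁ S₂ : ∀ k, List (Γ k)} {s t : ℕ}

theorem Within.mono (h : Within p v S v₁ S₁ s) (hst : s ≤ t) : Within p v S v₁ S₁ t :=
  let ⟨r, hr, hp⟩ := h
  ⟨r, hr.trans hst, hp⟩

theorem within_push (k : K) (f : σ → Γ k) :
    Within (push k f) v S v (Function.update S k (f v :: S k)) 1 :=
  ⟨1, le_rfl, .push ..⟩

theorem within_pop (k : K) (f : σ → Option (Γ k) → σ) :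
    Within (pop k f) v S (f v (S k).head?) (Function.update S k (S k).tail) 1 :=
  ⟨1, le_rfl, .pop ..⟩

theorem within_load (f : σ → σ) : Within (load f) v S (f v) S 1 :=
  ⟨1, le_rfl, .load ..⟩

theorem Within.seq (hp : Within p v S v₁ S₁ s) (hq : Within q v₁ S₁ v₂ S₂ t) :
    Within (.seq p q) v S v₂ S₂ (s + t) :=
  let ⟨_, h, hp⟩ := hp
  let ⟨_, h', hq⟩ := hq
  ⟨_, Nat.add_le_add h h', .seq hp hq⟩

theorem Within.ite_true {c : σ → Bool} (hc : c v = true) (hp : Within p v S v₁ S₁ t) :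
    Within (.ite c p q) v S v₁ S₁ (1 + t) :=
  let ⟨_, h, hp⟩ := hp
  ⟨_, Nat.add_le_add le_rfl h, .ite_true hc hp⟩

theorem Within.ite_false {c : σ → Bool} (hc : c v = false) (hq : Within q v S v₁ S₁ t) :
    Within (.ite c p q) v S v₁ S₁ (1 + t) :=
  let ⟨_, h, hq⟩ := hq
  ⟨_, Nat.add_le_add le_rfl h, .ite_false hc hq⟩

theorem Within.loop_true {c : σ → Bool} (hc : c v = true) (hp : Within p v S v₁ S₁ s)
    (hl : Within (.loop c p) v₁ S₁ v₂ S₂ t) : Within (.loop c p) v S v₂ S₂ (1 + s + t) :=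
  let ⟨_, h, hp⟩ := hp
  let ⟨_, h', hl⟩ := hl
  ⟨_, Nat.add_le_add (Nat.add_le_add le_rfl h) h', .loop_true hc hp hl⟩

theorem within_loop_false {c : σ → Bool} (hc : c v = false) : Within (.loop c p) v S v S 1 :=
  ⟨1, le_rfl, .loop_false hc⟩

/-- Pop the elements of the stack `k` one after the other until it is empty, and run `body` after
each of them. -/
def forEach (k : K) (set : σ → Option (Γ k) → σ) (get : σ → Option (Γ k)) (body : Prog Γ σ) :
    Prog Γ σ :=
  seq (pop k set) (loop (fun v => (get v).isSome) (seq body (pop k set)))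

section ForEach

variable {k : K} {set : σ → Option (Γ k) → σ} {get : σ → Option (Γ k)} {body : Prog Γ σ}
  (hget : ∀ v a, get (set v a) = a)

include hget in
theorem within_forEach_nil (h : S k = []) :
    Within (forEach k set get body) v S (set v none) S 2 := by
  have h1 := (within_pop (v := v) (S := S) k set).seq
    (within_loop_false (c := fun v => (get v).isSome) (p := .seq body (pop k set))
      (by simp [hget, h]))
  have h2 : Function.update S k (S k).tail = S := by
    rw [h, List.tail_nil, ← h, Function.update_eq_self]
  rw [h2, h] at h1
  exact h1

include hget in
-- The run `hr` starts with its own pop, which is regrouped with `body` into one iteration of the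
-- loop. The two extra steps are the first pop and the loop test.
theorem within_forEach_cons {a : Γ k} {l : List (Γ k)} (h : S k = a :: l)
    (hb : Within body (set v (some a)) (Function.update S k l) v₁ S₁ s)
    (hr : Within (forEach k set get body) v₁ S₁ v₂ S₂ t) :
    Within (forEach k set get body) v S v₂ S₂ (s + t + 2) := by
  obtain ⟨r, hr', hb⟩ := hb
  obtain ⟨r', hr'', hr⟩ := hr
  cases hr with
  | seq h1 h2 =>
    rename_i w R s' t'
    have h3 := Runs.loop_true (c := fun v => (get v).isSome) (by simp [hget]) (hb.seq h1) h2
    have h4 := (Runs.pop (Γ := Γ) k set v S)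
    rw [h] at h4
    refine ⟨_, ?_, h4.seq h3⟩
    omega

include hget in
-- Moving a stack element by element reverses it. Each element costs a test, a push and a pop; the
-- other two steps are the first pop and the last test.
theorem within_forEach_push (hset : ∀ v a b, set (set v a) b = set v b) {k' : K} (hk : k' ≠ k)
    (g : Γ k → Γ k') {f : σ → Γ k'} (hf : ∀ v a, f (set v (some a)) = g a) (v : σ)
    (S : ∀ k, List (Γ k)) :
    Within (forEach k set get (push k' f)) v S (set v none)
      (Function.update (Function.update S k []) k' (((S k).map g).reverse ++ S k'))
      (3 * (S k).length + 2) := by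
  generalize hl : S k = l
  induction l generalizing v S with
  | nil =>
    have h := within_forEach_nil (body := push k' f) hget (v := v) hl
    have h2 : Function.update (Function.update S k []) k' (S k') = S := by
      rw [← hl, Function.update_eq_self, Function.update_eq_self]
    simpa [h2] using h
  | cons a l ih =>
    have h := ih (set v (some a)) (Function.update (Function.update S k l) k' (g a :: S k'))
      (by rw [Function.update_of_ne hk.symm, Function.update_self])
    rw [hset] at h
    have h1 := within_forEach_cons (body := push k' f) hget (v := v) hl (within_push k' f)
      (by rw [hf, Function.update_of_ne hk]; exact h)
    convert h1.mono (t := 3 * (a :: l).length + 2) (by simp; omega) using 1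
    rw [Function.update_comm hk, Function.update_idem, Function.update_comm hk.symm,
      Function.update_idem, Function.update_self]
    simp [Function.update_comm hk]

include hget in
theorem within_forEach_load_id (hset : ∀ v a b, set (set v a) b = set v b) (v : σ)
    (S : ∀ k, List (Γ k)) :
    Within (forEach k set get (load id)) v S (set v none) (Function.update S k [])
      (3 * (S k).length + 2) := by
  generalize hl : S k = l
  induction l generalizing v S with
  | nil =>
    have h := within_forEach_nil (body := load id) hget (v := v) hl
    have h2 : Function.update S k [] = S := by rw [← hl, Function.update_eq_self]
    simpa [h2] using h
  | cons a l ih =>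
    have h := ih (set v (some a)) (Function.update S k l) (Function.update_self ..)
    rw [hset, Function.update_idem] at h
    exact (within_forEach_cons (body := load id) hget (v := v) hl (within_load id) h).mono
      (by simp; omega)

end ForEach

end Prog

/-! ### Arc consistency on a table of domains -/

section Table

variable {D : Type} [Fintype D] [DecidableEq D]

/-- The domain of a variable according to a table of domain restrictions. -/
def domOf (T : List (List Bool × Finset D)) (x : List Bool) : Finset D :=
  T.foldl (fun A e => if e.1 = x then A ∩ e.2 else A) Finset.univ

/-- The table written as a word: each name is followed by its domain restriction. -/
def flatten (T : List (List Bool × Finset D)) : List (Bool ⊕ Finset D) :=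
  T.flatMap fun e => e.1.map Sum.inl ++ [Sum.inr e.2]

omit [Fintype D] [DecidableEq D] in
theorem flatten_cons (e : List Bool × Finset D) (T : List (List Bool × Finset D)) :
    flatten (e :: T) = e.1.map Sum.inl ++ Sum.inr e.2 :: flatten T := by
  simp [flatten]

/-- A table of domain restrictions, with the information whether the last round has changed a
domain, and whether an empty domain was found. -/
structure Progress (D : Type) where
  table : List (List Bool × Finset D)
  changed : Bool
  empty : Bool

/-- The elements of the domain of `x` that are consistent with the constraint `y = g x`. -/
def support (g : D → D) (x y : List Bool) (T : List (List Bool × Finset D)) : Finset D :=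
  (domOf T x).filter fun d => g d ∈ domOf T y

/-- Restrict the domains of `x` and `y` according to the constraint `y = g x`. -/
def propagate (g : D → D) (x y : List Bool) (s : Progress D) : Progress D where
  table := (x, support g x y s.table) :: (y, (support g x y s.table).image g) :: s.table
  changed := s.changed || (decide (support g x y s.table ≠ domOf s.table x) ||
    decide ((support g x y s.table).image g ≠ domOf s.table y))
  empty := s.empty || decide (support g x y s.table = ∅)

end Table

/-! ### The program -/

/-- The stacks of the program: two for the input, two for the table of domains, three for names of
variables, and one for the output. -/
inductive Stack : Type where
  | inp | cons | tab | aux | key | key' | fst | out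
  deriving DecidableEq

instance : Fintype Stack :=
  ⟨{.inp, .cons, .tab, .aux, .key, .key', .fst, .out}, fun k => by cases k <;> decide⟩

section Machine

variable {D : Type} {S : Set (FinRel D)}

/-- The alphabets of the stacks. -/
def Alphabet (S : Set (FinRel D)) : Stack → Type
  | .inp => Sym S
  | .cons => Sym S
  | .tab => Bool ⊕ Finset D
  | .aux => Bool ⊕ Finset D
  | .key => Bool
  | .key' => Bool
  | .fst => Bool
  | .out => Bool

/-- The internal state of the program. -/
structure Reg (S : Set (FinRel D)) where
  sym : Option (Sym S)
  ent : Option (Bool ⊕ Finset D)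
  bit : Option Bool
  eq : Bool
  acc : Finset D
  dom : Finset D
  second : Bool
  changed : Bool
  empty : Bool

/-- The contents of the stacks. -/
structure Mem (S : Set (FinRel D)) where
  inp : List (Sym S)
  cons : List (Sym S)
  tab : List (Bool ⊕ Finset D)
  aux : List (Bool ⊕ Finset D)
  key : List Bool
  key' : List Bool
  fst : List Bool
  out : List Bool

def Mem.stk (m : Mem S) : (k : Stack) → List (Alphabet S k)
  | .inp => m.inp
  | .cons => m.cons
  | .tab => m.tab
  | .aux => m.aux
  | .key => m.key
  | .key' => m.key'
  | .fst => m.fst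
  | .out => m.out

def Mem.set (m : Mem S) : (k : Stack) → List (Alphabet S k) → Mem S
  | .inp, l => { m with inp := l }
  | .cons, l => { m with cons := l }
  | .tab, l => { m with tab := l }
  | .aux, l => { m with aux := l }
  | .key, l => { m with key := l }
  | .key', l => { m with key' := l }
  | .fst, l => { m with fst := l }
  | .out, l => { m with out := l }

theorem Mem.update_stk (m : Mem S) (k : Stack) (l : List (Alphabet S k)) :
    Function.update m.stk k l = (m.set k l).stk := by
  funext k'
  by_cases h : k' = k
  · subst h
    rw [Function.update_self]
    cases k' <;> rfl
  · rw [Function.update_of_ne h]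
    cases k <;> cases k' <;> first | rfl | exact absurd rfl h

/-- The program runs from one configuration to another in at most `t` steps. -/
def Exec (p : Prog (Alphabet S) (Reg S)) (v : Reg S) (m : Mem S) (v' : Reg S) (m' : Mem S)
    (t : ℕ) : Prop :=
  p.Within v m.stk v' m'.stk t

section Exec

variable {p q : Prog (Alphabet S) (Reg S)} {v v₁ v₂ : Reg S} {m m₁ m₂ : Mem S} {s t : ℕ}

theorem Exec.mono (h : Exec p v m v₁ m₁ s) (hst : s ≤ t) : Exec p v m v₁ m₁ t :=
  Prog.Within.mono h hst

theorem Exec.seq (hp : Exec p v m v₁ m₁ s) (hq : Exec q v₁ m₁ v₂ m₂ t) :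
    Exec (.seq p q) v m v₂ m₂ (s + t) :=
  Prog.Within.seq hp hq

theorem Exec.ite_true {c : Reg S → Bool} (hc : c v = true) (hp : Exec p v m v₁ m₁ t) :
    Exec (.ite c p q) v m v₁ m₁ (1 + t) :=
  Prog.Within.ite_true hc hp

theorem Exec.ite_false {c : Reg S → Bool} (hc : c v = false) (hq : Exec q v m v₁ m₁ t) :
    Exec (.ite c p q) v m v₁ m₁ (1 + t) :=
  Prog.Within.ite_false hc hq

theorem Exec.loop_true {c : Reg S → Bool} (hc : c v = true) (hp : Exec p v m v₁ m₁ s)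
    (hl : Exec (.loop c p) v₁ m₁ v₂ m₂ t) : Exec (.loop c p) v m v₂ m₂ (1 + s + t) :=
  Prog.Within.loop_true hc hp hl

theorem exec_loop_false {c : Reg S → Bool} (hc : c v = false) : Exec (.loop c p) v m v m 1 :=
  Prog.within_loop_false hc

theorem exec_load (f : Reg S → Reg S) : Exec (.load f) v m (f v) m 1 :=
  Prog.within_load f

theorem exec_push (k : Stack) (f : Reg S → Alphabet S k) :
    Exec (.push k f) v m v (m.set k (f v :: m.stk k)) 1 := by
  have h := Prog.within_push (v := v) (S := m.stk) k f
  rwa [Mem.update_stk] at h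

theorem exec_pop (k : Stack) (f : Reg S → Option (Alphabet S k) → Reg S) :
    Exec (.pop k f) v m (f v (m.stk k).head?) (m.set k (m.stk k).tail) 1 := by
  have h := Prog.within_pop (v := v) (S := m.stk) k f
  rwa [Mem.update_stk] at h

variable {k : Stack} {set : Reg S → Option (Alphabet S k) → Reg S}
  {get : Reg S → Option (Alphabet S k)} (hget : ∀ v a, get (set v a) = a)

include hget in
theorem exec_forEach_nil (h : m.stk k = []) :
    Exec (.forEach k set get p) v m (set v none) m 2 :=
  Prog.within_forEach_nil hget h

include hget in
theorem exec_forEach_cons {a : Alphabet S k} {l : List (Alphabet S k)} (h : m.stk k = a :: l)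
    (hb : Exec p (set v (some a)) (m.set k l) v₁ m₁ s)
    (hr : Exec (.forEach k set get p) v₁ m₁ v₂ m₂ t) :
    Exec (.forEach k set get p) v m v₂ m₂ (s + t + 2) := by
  refine Prog.within_forEach_cons hget h ?_ hr
  rwa [Mem.update_stk]

include hget in
theorem exec_forEach_push (hset : ∀ v a b, set (set v a) b = set v b) {k' : Stack} (hk : k' ≠ k)
    (g : Alphabet S k → Alphabet S k') {f : Reg S → Alphabet S k'}
    (hf : ∀ v a, f (set v (some a)) = g a) (v : Reg S) (m : Mem S)
    {l : List (Alphabet S k')} (hl : (m.stk k).map g = l) :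
    Exec (.forEach k set get (.push k' f)) v m (set v none)
      ((m.set k []).set k' (l.reverse ++ m.stk k'))
      (3 * (m.stk k).length + 2) := by
  subst hl
  have h := Prog.within_forEach_push hget hset hk g hf v m.stk
  rwa [Mem.update_stk, Mem.update_stk] at h

include hget in
theorem exec_forEach_load_id (hset : ∀ v a b, set (set v a) b = set v b) (v : Reg S)
    (m : Mem S) :
    Exec (.forEach k set get (.load id)) v m (set v none) (m.set k [])
      (3 * (m.stk k).length + 2) := by
  have h := Prog.within_forEach_load_id hget hset v m.stk
  rwa [Mem.update_stk] at h

end Exec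

/-! ### Pouring one stack onto another -/

def Reg.setSym (v : Reg S) (a : Option (Sym S)) : Reg S := { v with sym := a }
def Reg.setEnt (v : Reg S) (a : Option (Bool ⊕ Finset D)) : Reg S := { v with ent := a }
def Reg.setBit (v : Reg S) (a : Option Bool) : Reg S := { v with bit := a }

theorem exec_pour_inp_cons (v : Reg S) (m : Mem S) :
    Exec (.forEach .inp Reg.setSym Reg.sym (.push .cons (fun v => v.sym.getD .var))) v m
      { v with sym := none } { m with inp := [], cons := m.inp.reverse ++ m.cons }
      (3 * m.inp.length + 2) := by
  exact exec_forEach_push (k := .inp) (k' := .cons) (set := Reg.setSym) (get := Reg.sym)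
    (fun _ _ => rfl) (fun _ _ _ => rfl) (by decide) id (f := fun v => v.sym.getD .var)
    (fun _ _ => rfl) v m (List.map_id _)

theorem exec_pour_aux_tab (v : Reg S) (m : Mem S) :
    Exec (.forEach .aux Reg.setEnt Reg.ent (.push .tab (fun v => v.ent.getD (.inl false)))) v m
      { v with ent := none } { m with aux := [], tab := m.aux.reverse ++ m.tab }
      (3 * m.aux.length + 2) := by
  exact exec_forEach_push (k := .aux) (k' := .tab) (set := Reg.setEnt) (get := Reg.ent)
    (fun _ _ => rfl) (fun _ _ _ => rfl) (by decide) id (f := fun v => v.ent.getD (.inl false))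
    (fun _ _ => rfl) v m (List.map_id _)

theorem exec_pour_key_fst (v : Reg S) (m : Mem S) :
    Exec (.forEach .key Reg.setBit Reg.bit (.push .fst (fun v => v.bit.getD false))) v m
      { v with bit := none } { m with key := [], fst := m.key.reverse ++ m.fst }
      (3 * m.key.length + 2) := by
  exact exec_forEach_push (k := .key) (k' := .fst) (set := Reg.setBit) (get := Reg.bit)
    (fun _ _ => rfl) (fun _ _ _ => rfl) (by decide) id (f := fun v => v.bit.getD false)
    (fun _ _ => rfl) v m (List.map_id _)

theorem exec_pour_key_key' (v : Reg S) (m : Mem S) :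
    Exec (.forEach .key Reg.setBit Reg.bit (.push .key' (fun v => v.bit.getD false))) v m
      { v with bit := none } { m with key := [], key' := m.key.reverse ++ m.key' }
      (3 * m.key.length + 2) := by
  exact exec_forEach_push (k := .key) (k' := .key') (set := Reg.setBit) (get := Reg.bit)
    (fun _ _ => rfl) (fun _ _ _ => rfl) (by decide) id (f := fun v => v.bit.getD false)
    (fun _ _ => rfl) v m (List.map_id _)

theorem exec_pour_key'_key (v : Reg S) (m : Mem S) :
    Exec (.forEach .key' Reg.setBit Reg.bit (.push .key (fun v => v.bit.getD false))) v m
      { v with bit := none } { m with key' := [], key := m.key'.reverse ++ m.key }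
      (3 * m.key'.length + 2) := by
  exact exec_forEach_push (k := .key') (k' := .key) (set := Reg.setBit) (get := Reg.bit)
    (fun _ _ => rfl) (fun _ _ _ => rfl) (by decide) id (f := fun v => v.bit.getD false)
    (fun _ _ => rfl) v m (List.map_id _)

theorem exec_pour_fst_tab (v : Reg S) (m : Mem S) :
    Exec (.forEach .fst Reg.setBit Reg.bit (.push .tab (fun v => Sum.inl (v.bit.getD false)))) v m
      { v with bit := none } { m with fst := [], tab := (m.fst.map Sum.inl).reverse ++ m.tab }
      (3 * m.fst.length + 2) := by
  exact exec_forEach_push (k := .fst) (k' := .tab) (set := Reg.setBit) (get := Reg.bit)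
    (fun _ _ => rfl) (fun _ _ _ => rfl) (by decide) Sum.inl (f := fun v => Sum.inl (v.bit.getD false))
    (fun _ _ => rfl) v m rfl

theorem exec_pour_key'_tab (v : Reg S) (m : Mem S) :
    Exec (.forEach .key' Reg.setBit Reg.bit (.push .tab (fun v => Sum.inl (v.bit.getD false)))) v m
      { v with bit := none } { m with key' := [], tab := (m.key'.map Sum.inl).reverse ++ m.tab }
      (3 * m.key'.length + 2) := by
  exact exec_forEach_push (k := .key') (k' := .tab) (set := Reg.setBit) (get := Reg.bit)
    (fun _ _ => rfl) (fun _ _ _ => rfl) (by decide) Sum.inl (f := fun v => Sum.inl (v.bit.getD false))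
    (fun _ _ => rfl) v m rfl

/-! ### Looking up a domain in the table -/

variable [Fintype D] [DecidableEq D]

/-- The bit to be compared with the next bit of the key. -/
def Reg.expected (v : Reg S) : Option Bool := v.ent.bind Sum.getLeft?

/-- The domain restriction that was read last. -/
def Reg.restriction (v : Reg S) : Finset D := (v.ent.bind Sum.getRight?).getD Finset.univ

local infixr:60 " ⨟ " => Prog.seq

/-- Compare a symbol of the table with the key. -/
def scanStep (S : Set (FinRel D)) : Prog (Alphabet S) (Reg S) :=
  .push .aux (fun v => v.ent.getD (.inl false)) ⨟
  .pop .key Reg.setBit ⨟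
  -- An exhausted key gives `none`, and so does `expected` at the end of an entry; the test
  -- therefore also rejects names that are proper prefixes of each other.
  .load (fun v => { v with eq := v.eq && (v.bit == v.expected) }) ⨟
  .ite (fun v => v.bit.isSome) (.push .key' (fun v => v.bit.getD false)) (.load id) ⨟
  .ite (fun v => v.expected.isSome) (.load id)
    (.forEach .key' Reg.setBit Reg.bit (.push .key (fun v => v.bit.getD false)) ⨟
      .load (fun v =>
        { v with acc := if v.eq then v.acc ∩ v.restriction else v.acc, eq := true }))

/-- Compare the table with the key, and collect the restrictions of its domain. -/
def scan (S : Set (FinRel D)) : Prog (Alphabet S) (Reg S) :=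
  .forEach .tab Reg.setEnt Reg.ent (scanStep S)

/-- Compute the domain of the key. -/
def lookup (S : Set (FinRel D)) : Prog (Alphabet S) (Reg S) :=
  .load (fun v => { v with acc := Finset.univ, eq := true, bit := none }) ⨟
    scan S ⨟
    .forEach .aux Reg.setEnt Reg.ent (.push .tab (fun v => v.ent.getD (.inl false)))

theorem exec_scanStep_bit (b : Bool) (v : Reg S) (m : Mem S) (hv : v.ent = some (.inl b)) :
    Exec (scanStep S) v m
      { v with bit := m.key.head?, eq := v.eq && (m.key.head? == some b) }
      { m with
        aux := .inl b :: m.aux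
        key := m.key.tail
        key' := m.key.head?.toList ++ m.key' } 7 := by
  obtain ⟨minp, mcons, mtab, maux, mkey, mkey', mfst, mout⟩ := m
  obtain ⟨vs, ve, vb, veq, va, vd, vse, vc, vem⟩ := v
  cases hv
  rcases mkey with _ | ⟨c, mkey⟩
  · exact ((exec_push ..).seq <| (exec_pop ..).seq <| (exec_load _).seq <|
      (Exec.ite_false rfl (exec_load _)).seq <| Exec.ite_true rfl (exec_load _))
  · exact ((exec_push ..).seq <| (exec_pop ..).seq <| (exec_load _).seq <|
      (Exec.ite_true rfl (exec_push ..)).seq <| Exec.ite_true rfl (exec_load _))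

theorem exec_scanStep_restriction (A : Finset D) (v : Reg S) (m : Mem S)
    (hv : v.ent = some (.inr A)) :
    Exec (scanStep S) v m
      { v with
        bit := none
        eq := true
        acc := if v.eq = true ∧ m.key = [] then v.acc ∩ A else v.acc }
      { m with
        aux := .inr A :: m.aux
        key := m.key'.reverse ++ m.key
        key' := [] } (3 * m.key'.length + 16) := by
  obtain ⟨minp, mcons, mtab, maux, mkey, mkey', mfst, mout⟩ := m
  obtain ⟨vs, ve, vb, veq, va, vd, vse, vc, vem⟩ := v
  cases hv
  rcases mkey with _ | ⟨c, mkey⟩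
  · have h : Exec (scanStep S) ⟨vs, some (.inr A), vb, veq, va, vd, vse, vc, vem⟩
        ⟨minp, mcons, mtab, maux, [], mkey', mfst, mout⟩
        ⟨vs, some (.inr A), none, true, if (veq && true) = true then va ∩ A else va,
          vd, vse, vc, vem⟩
        ⟨minp, mcons, mtab, .inr A :: maux, mkey'.reverse ++ [], [], mfst, mout⟩
        (1 + (1 + (1 + (1 + 1 + (1 + (3 * mkey'.length + 2 + 1)))))) :=
      ((exec_push ..).seq <| (exec_pop ..).seq <| (exec_load _).seq <|
        (Exec.ite_false rfl (exec_load _)).seq <|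
        Exec.ite_false rfl <| (exec_pour_key'_key ..).seq (exec_load _))
    convert h.mono ?_ using 1
    · simp
    · simp; omega
  · have h : Exec (scanStep S) ⟨vs, some (.inr A), vb, veq, va, vd, vse, vc, vem⟩
        ⟨minp, mcons, mtab, maux, c :: mkey, mkey', mfst, mout⟩
        ⟨vs, some (.inr A), none, true, if (veq && false) = true then va ∩ A else va,
          vd, vse, vc, vem⟩
        ⟨minp, mcons, mtab, .inr A :: maux, (c :: mkey').reverse ++ mkey, [],
          mfst, mout⟩
        (1 + (1 + (1 + (1 + 1 + (1 + (3 * (c :: mkey').length + 2 + 1)))))) :=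
      ((exec_push ..).seq <| (exec_pop ..).seq <| (exec_load _).seq <|
        (Exec.ite_true rfl (exec_push ..)).seq <|
        Exec.ite_false rfl <| (exec_pour_key'_key ..).seq (exec_load _))
    convert h.mono ?_ using 1
    · simp
    · simp
    · simp; omega

theorem exec_scan_cons {v v₁ v₂ : Reg S} {m m₁ m₂ : Mem S} {s t : ℕ}
    (hm : m.tab ≠ []) (hb : Exec (scanStep S) { v with ent := m.tab.head? }
      { m with tab := m.tab.tail } v₁ m₁ s)
    (hr : Exec (scan S) v₁ m₁ v₂ m₂ t) : Exec (scan S) v m v₂ m₂ (s + t + 2) := by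
  obtain ⟨minp, mcons, _ | ⟨a, l⟩, maux, mkey, mkey', mfst, mout⟩ := m
  · exact absurd rfl hm
  · exact exec_forEach_cons (fun _ _ => rfl) rfl hb hr

/-- Bits popped from the key wait on `key'` and are put back at the end of the entry, so the next
entry meets the whole key. For the induction, part of the key may already be on `key'`; the term `3
* m.key'.length` pays for its return. -/
theorem exec_scan_entry (nm : List Bool) (A : Finset D) (rest : List (Bool ⊕ Finset D))
    (v v₂ : Reg S) (m m₂ : Mem S) (t : ℕ) (hm : m.tab = nm.map Sum.inl ++ Sum.inr A :: rest)
    (h : Exec (scan S) { v with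
        ent := some (Sum.inr A)
        bit := none
        eq := true
        acc := if v.eq = true ∧ nm = m.key then v.acc ∩ A else v.acc }
      { m with
        tab := rest
        aux := Sum.inr A :: ((nm.map Sum.inl).reverse ++ m.aux)
        key := m.key'.reverse ++ m.key
        key' := [] } v₂ m₂ t) :
    Exec (scan S) v m v₂ m₂ (t + 20 * (nm.length + 1) + 3 * m.key'.length) := by
  obtain ⟨minp, mcons, mtab, maux, mkey, mkey', mfst, mout⟩ := m
  obtain ⟨vs, ve, vb, veq, va, vd, vse, vc, vem⟩ := v
  induction nm generalizing mtab maux mkey mkey' ve vb veq with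
  | nil =>
    cases hm
    refine Exec.mono (exec_scan_cons (List.cons_ne_nil _ _)
      (exec_scanStep_restriction A _ _ rfl) (t := t) ?_) ?_
    · simpa [eq_comm] using h
    · simp; omega
  | cons b nm ih =>
    cases hm
    refine Exec.mono (exec_scan_cons (List.cons_ne_nil _ _)
      (exec_scanStep_bit b _ _ rfl) (ih (hm := rfl) (h := ?_))) ?_
    · rcases mkey with _ | ⟨c, mkey⟩
      · simpa using h
      · have e : ((veq = true ∧ c = b) ∧ nm = mkey) ↔ (veq = true ∧ b = c ∧ nm = mkey) := by
          rw [and_assoc, eq_comm (a := c)]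
        simpa [e] using h
    · rcases mkey with _ | ⟨c, mkey⟩ <;> simp <;> omega

theorem exec_scan (T : List (List Bool × Finset D)) (v : Reg S) (m : Mem S)
    (hm : m.tab = flatten T) (heq : v.eq = true) (hbit : v.bit = none) (hkey : m.key' = []) :
    Exec (scan S) v m
      { v with
        ent := none
        acc := T.foldl (fun A e => if e.1 = m.key then A ∩ e.2 else A) v.acc }
      { m with tab := [], aux := (flatten T).reverse ++ m.aux }
      (20 * (flatten T).length + 2) := by
  obtain ⟨minp, mcons, mtab, maux, mkey, mkey', mfst, mout⟩ := m
  obtain ⟨vs, ve, vb, veq, va, vd, vse, vc, vem⟩ := v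
  obtain rfl : mtab = flatten T := hm
  cases heq
  cases hbit
  cases hkey
  induction T generalizing ve va maux with
  | nil => exact exec_forEach_nil (fun _ _ => rfl) rfl
  | cons e T ih =>
    refine Exec.mono (exec_scan_entry e.1 e.2 (flatten T) _ _ _ _ _ (flatten_cons e T) ?_)
      (s := 20 * (flatten T).length + 2 + 20 * (e.1.length + 1) + 3 * 0) ?_
    · convert ih (ve := some (.inr e.2)) (va := if e.1 = mkey then va ∩ e.2 else va)
        (maux := .inr e.2 :: ((e.1.map Sum.inl).reverse ++ maux)) using 1 <;>
        simp [flatten_cons]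
    · simp [flatten_cons]; omega

theorem exec_lookup (T : List (List Bool × Finset D)) (v : Reg S) (m : Mem S)
    (hm : m.tab = flatten T) (hkey : m.key' = []) (haux : m.aux = []) :
    Exec (lookup S) v m
      { v with ent := none, bit := none, eq := true, acc := domOf T m.key } m
      (23 * (flatten T).length + 5) := by
  obtain ⟨minp, mcons, mtab, maux, mkey, mkey', mfst, mout⟩ := m
  obtain ⟨vs, ve, vb, veq, va, vd, vse, vc, vem⟩ := v
  obtain rfl : mtab = flatten T := hm
  cases hkey
  cases haux
  have h : Exec (lookup S) ⟨vs, ve, vb, veq, va, vd, vse, vc, vem⟩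
      ⟨minp, mcons, flatten T, [], mkey, [], mfst, mout⟩
      ⟨vs, none, none, true, domOf T mkey, vd, vse, vc, vem⟩
      ⟨minp, mcons, ((flatten T).reverse ++ []).reverse ++ [], [], mkey, [], mfst, mout⟩
      (1 + (20 * (flatten T).length + 2 + (3 * ((flatten T).reverse ++ []).length + 2))) :=
    (exec_load _).seq <| (exec_scan T _ _ rfl rfl rfl rfl).seq <|
      exec_pour_aux_tab _ _
  convert h.mono ?_ using 1
  · simp
  · simp; omega

end Machine

/-! ### Processing the input symbol by symbol -/

section Machine

variable {D : Type} [Fintype D] [DecidableEq D] {S : Set (FinRel D)}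

local infixr:60 " ⨟ " => Prog.seq

/-- The bit that was read last from the input, if any. -/
def Reg.inputBit (v : Reg S) : Option Bool :=
  match v.sym with
  | some (.bit b) => some b
  | _ => none

/-- The relation that was read last from the input, if any. -/
def Reg.inputRel (v : Reg S) : Option S :=
  match v.sym with
  | some (.rel R) => some R
  | _ => none

/-- Whether a variable symbol was read last from the input. -/
def Reg.inputVar (v : Reg S) : Bool :=
  match v.sym with
  | some .var => true
  | _ => false

/-- Restrict `acc` and `dom` according to the constraint with the function `g`. -/
def Reg.restrict (g : D → D) (v : Reg S) : Reg S :=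
  { v with
    acc := v.acc.filter fun d => g d ∈ v.dom
    dom := (v.acc.filter fun d => g d ∈ v.dom).image g
    changed := v.changed || (decide ((v.acc.filter fun d => g d ∈ v.dom) ≠ v.acc) ||
      decide ((v.acc.filter fun d => g d ∈ v.dom).image g ≠ v.dom))
    empty := v.empty || decide ((v.acc.filter fun d => g d ∈ v.dom) = ∅) }

/-- Look up the domain of the variable whose name was read, and set it aside if it is the first
one. -/
def readVar (S : Set (FinRel D)) : Prog (Alphabet S) (Reg S) :=
  lookup S ⨟
  .ite Reg.second (.load (fun v => { v with second := false }))
    (.load (fun v => { v with dom := v.acc, second := true }) ⨟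
      .forEach .key Reg.setBit Reg.bit (.push .fst (fun v => v.bit.getD false)))

/-- Restrict the domains of the two variables that were read. -/
def readRel (fn : S → D → D) : Prog (Alphabet S) (Reg S) :=
  .load (fun v => v.inputRel.elim v fun R => v.restrict (fn R)) ⨟
  -- Entries are written from their end, so that on the stack each name lies above its restriction.
  .push .tab (fun v => .inr v.dom) ⨟
  .forEach .fst Reg.setBit Reg.bit (.push .tab (fun v => .inl (v.bit.getD false))) ⨟
  .push .tab (fun v => .inr v.acc) ⨟
  .forEach .key Reg.setBit Reg.bit (.push .key' (fun v => v.bit.getD false)) ⨟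
  .forEach .key' Reg.setBit Reg.bit (.push .tab (fun v => .inl (v.bit.getD false)))

/-- Process a symbol of the input, which is read from right to left. -/
def readSym (fn : S → D → D) : Prog (Alphabet S) (Reg S) :=
  .push .inp (fun v => v.sym.getD .var) ⨟
  .ite (fun v => v.inputBit.isSome) (.push .key (fun v => v.inputBit.getD false))
    (.ite Reg.inputVar (readVar S)
      (.ite (fun v => v.inputRel.isSome) (readRel fn)
        -- The remaining symbol is `∃`. The name next to it was set aside like the last argument of
        -- a constraint, and is now forgotten.
        (.forEach .fst Reg.setBit Reg.bit (.load id) ⨟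
          .load (fun v => { v with second := false }))))

/-- Process all constraints. -/
def sweep (fn : S → D → D) : Prog (Alphabet S) (Reg S) :=
  .forEach .cons Reg.setSym Reg.sym (readSym fn)

variable {fn : S → D → D}

theorem exec_readSym_bit (b : Bool) (v : Reg S) (m : Mem S) (hv : v.sym = some (.bit b)) :
    Exec (readSym fn) v m v { m with inp := .bit b :: m.inp, key := b :: m.key } 3 := by
  obtain ⟨vs, ve, vb, veq, va, vd, vse, vc, vem⟩ := v
  cases hv
  exact (exec_push ..).seq <| Exec.ite_true rfl <| exec_push ..

theorem exec_readSym_var_fst (T : List (List Bool × Finset D)) (v : Reg S) (m : Mem S)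
    (hv : v.sym = some .var) (hv' : v.second = false)
    (hm : m.tab = flatten T) (hkey : m.key' = []) (haux : m.aux = []) :
    Exec (readSym fn) v m
      { v with ent := none, bit := none, eq := true, acc := domOf T m.key, dom := domOf T m.key,
               second := true }
      { m with inp := .var :: m.inp, key := [], fst := m.key.reverse ++ m.fst }
      (23 * (flatten T).length + 3 * m.key.length + 12) := by
  obtain ⟨minp, mcons, mtab, maux, mkey, mkey', mfst, mout⟩ := m
  obtain ⟨vs, ve, vb, veq, va, vd, vse, vc, vem⟩ := v
  obtain rfl : mtab = flatten T := hm
  cases hkey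
  cases haux
  cases hv
  cases hv'
  have h : Exec (readSym fn) ⟨some .var, ve, vb, veq, va, vd, false, vc, vem⟩
      ⟨minp, mcons, flatten T, [], mkey, [], mfst, mout⟩
      ⟨some .var, none, none, true, domOf T mkey, domOf T mkey, true, vc, vem⟩
      ⟨.var :: minp, mcons, flatten T, [], [], [], mkey.reverse ++ mfst, mout⟩
      (1 + (1 + (1 + (23 * (flatten T).length + 5 + (1 + (1 + (3 * mkey.length + 2))))))) :=
    (exec_push ..).seq <| Exec.ite_false rfl <| Exec.ite_true rfl <|
      (exec_lookup T _ _ rfl rfl rfl).seq <| Exec.ite_false rfl <| (exec_load _).seq <|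
      exec_pour_key_fst _ _
  convert h.mono ?_ using 1
  all_goals first | (simp; done) | (simp; omega)

theorem exec_readSym_var_snd (T : List (List Bool × Finset D)) (v : Reg S) (m : Mem S)
    (hv : v.sym = some .var) (hv' : v.second = true)
    (hm : m.tab = flatten T) (hkey : m.key' = []) (haux : m.aux = []) :
    Exec (readSym fn) v m
      { v with ent := none, bit := none, eq := true, acc := domOf T m.key, second := false }
      { m with inp := .var :: m.inp } (23 * (flatten T).length + 12) := by
  obtain ⟨minp, mcons, mtab, maux, mkey, mkey', mfst, mout⟩ := m
  obtain ⟨vs, ve, vb, veq, va, vd, vse, vc, vem⟩ := v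
  obtain rfl : mtab = flatten T := hm
  cases hkey
  cases haux
  cases hv
  cases hv'
  have h : Exec (readSym fn) ⟨some .var, ve, vb, veq, va, vd, true, vc, vem⟩
      ⟨minp, mcons, flatten T, [], mkey, [], mfst, mout⟩
      ⟨some .var, none, none, true, domOf T mkey, vd, false, vc, vem⟩
      ⟨.var :: minp, mcons, flatten T, [], mkey, [], mfst, mout⟩
      (1 + (1 + (1 + (23 * (flatten T).length + 5 + (1 + 1))))) :=
    (exec_push ..).seq <| Exec.ite_false rfl <| Exec.ite_true rfl <|
      (exec_lookup T _ _ rfl rfl rfl).seq <| Exec.ite_true rfl <| exec_load _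
  exact h.mono (by omega)

theorem exec_readSym_exist (v : Reg S) (m : Mem S) (hv : v.sym = some .exist) :
    Exec (readSym fn) v m { v with bit := none, second := false }
      { m with inp := .exist :: m.inp, fst := [] } (3 * m.fst.length + 8) := by
  obtain ⟨vs, ve, vb, veq, va, vd, vse, vc, vem⟩ := v
  cases hv
  refine Exec.mono (s := 1 + (1 + (1 + (1 + (3 * m.fst.length + 2 + 1))))) ?_ (by omega)
  exact (exec_push ..).seq <| Exec.ite_false rfl <| Exec.ite_false rfl <| Exec.ite_false rfl <|
    (exec_forEach_load_id (k := .fst) (set := Reg.setBit) (fun _ _ => rfl) (fun _ _ _ => rfl) _ _).seq <| exec_load _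

theorem exec_readSym_rel (R : S) (v : Reg S) (m : Mem S) (hv : v.sym = some (.rel R))
    (hkey : m.key' = []) :
    Exec (readSym fn) v m
      { v.restrict (fn R) with bit := none }
      { m with
        inp := .rel R :: m.inp
        tab := m.key.map .inl ++ .inr (v.restrict (fn R)).acc ::
          ((m.fst.map .inl).reverse ++ .inr (v.restrict (fn R)).dom :: m.tab)
        key := []
        fst := [] } (6 * m.key.length + 3 * m.fst.length + 13) := by
  obtain ⟨minp, mcons, mtab, maux, mkey, mkey', mfst, mout⟩ := m
  obtain ⟨vs, ve, vb, veq, va, vd, vse, vc, vem⟩ := v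
  cases hkey
  cases hv
  have h : Exec (readSym fn) ⟨some (.rel R), ve, vb, veq, va, vd, vse, vc, vem⟩
      ⟨minp, mcons, mtab, maux, mkey, [], mfst, mout⟩
      { Reg.restrict (fn R) ⟨some (.rel R), ve, vb, veq, va, vd, vse, vc, vem⟩ with bit := none }
      ⟨.rel R :: minp, mcons, ((mkey.reverse ++ []).map Sum.inl).reverse ++
        .inr (va.filter fun d => fn R d ∈ vd) ::
          ((mfst.map Sum.inl).reverse ++ .inr ((va.filter fun d => fn R d ∈ vd).image (fn R)) :: mtab),
        maux, [], [], [], mout⟩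
      (1 + (1 + (1 + (1 + (1 + (1 + ((3 * mfst.length + 2) + (1 + ((3 * mkey.length + 2) +
        (3 * (mkey.reverse ++ []).length + 2)))))))))) :=
    (exec_push ..).seq <| Exec.ite_false rfl <| Exec.ite_false rfl <| Exec.ite_true rfl <|
      (exec_load _).seq <| (exec_push ..).seq <|
      (exec_pour_fst_tab _ _).seq <| (exec_push ..).seq <|
      (exec_pour_key_key' _ _).seq <|
      exec_pour_key'_tab _ _
  convert h.mono ?_ using 1
  · simp [Reg.restrict]
  · simp; omega

/-- Sweeping from one configuration leads to another in at most `c` steps. -/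
def SweepsTo (fn : S → D → D) (v : Reg S) (m : Mem S) (v' : Reg S) (m' : Mem S) (c : ℕ) : Prop :=
  ∀ v₂ m₂ t, Exec (sweep fn) v' m' v₂ m₂ t → Exec (sweep fn) v m v₂ m₂ (c + t)

variable {v v₁ v₂ : Reg S} {m m₁ m₂ : Mem S} {s t : ℕ}

theorem SweepsTo.trans (h : SweepsTo fn v m v₁ m₁ s) (h' : SweepsTo fn v₁ m₁ v₂ m₂ t) :
    SweepsTo fn v m v₂ m₂ (s + t) := fun _ _ _ h₂ =>
  (h _ _ _ (h' _ _ _ h₂)).mono (by omega)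

theorem SweepsTo.mono (h : SweepsTo fn v m v₁ m₁ s) (hst : s ≤ t) : SweepsTo fn v m v₁ m₁ t :=
  fun _ _ _ h₂ => (h _ _ _ h₂).mono (by omega)

theorem SweepsTo.cast (h : SweepsTo fn v m v₁ m₁ s) (hm : m₁ = m₂) (hst : s ≤ t) :
    SweepsTo fn v m v₁ m₂ t :=
  hm ▸ h.mono hst

theorem SweepsTo.head {a : Sym S} {l : List (Sym S)} (hm : m.cons = a :: l)
    (h : Exec (readSym fn) { v with sym := some a } { m with cons := l } v₁ m₁ s) :
    SweepsTo fn v m v₁ m₁ (s + 2) := fun _ _ _ h₂ =>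
  (exec_forEach_cons (fun _ _ => rfl) (show m.stk .cons = _ from hm) h h₂).mono (by omega)

/-- The bits arrive last one first, so pushing them restores the order of the name. The final `sym`
is existential because the name may be empty, as it is for the variable `0`. -/
theorem sweepsTo_name (w : List Bool) (rest : List (Sym S)) (v : Reg S) (m : Mem S)
    (hm : m.cons = (w.map .bit).reverse ++ rest) :
    ∃ s, SweepsTo fn v m { v with sym := s }
      { m with inp := w.map .bit ++ m.inp, cons := rest, key := w ++ m.key } (5 * w.length) := by
  obtain ⟨minp, mcons, mtab, maux, mkey, mkey', mfst, mout⟩ := m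
  cases hm
  induction w using List.reverseRecOn generalizing v minp mkey with
  | nil => exact ⟨v.sym, fun _ _ _ h => h.mono (by simp)⟩
  | append_singleton w b ih =>
    obtain ⟨s, hs⟩ := ih { v with sym := some (.bit b) } (.bit b :: minp) (b :: mkey)
    refine ⟨s, ?_⟩
    have h := (SweepsTo.head (a := .bit b) (l := (w.map .bit).reverse ++ rest) (v := v)
      (m := ⟨minp, ((w ++ [b]).map .bit).reverse ++ rest, mtab, maux, mkey, mkey', mfst, mout⟩)
      (by simp) (exec_readSym_bit (fn := fn) b _ _ rfl)).trans hs
    convert h.mono ?_ using 1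
    all_goals first | (simp; done) | (simp; omega)

theorem SweepsTo.name (h : SweepsTo fn v m v₁ m₁ s) (w : List Bool) (rest : List (Sym S))
    (hm : m₁.cons = (w.map .bit).reverse ++ rest) :
    ∃ a, SweepsTo fn v m { v₁ with sym := a }
      { m₁ with inp := w.map .bit ++ m₁.inp, cons := rest, key := w ++ m₁.key }
      (s + 5 * w.length) :=
  let ⟨a, ha⟩ := sweepsTo_name w rest v₁ m₁ hm
  ⟨a, h.trans ha⟩

/-- The code of a variable name. -/
def nameWord (S : Set (FinRel D)) (w : List Bool) : List (Sym S) := .var :: w.map .bit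

/-- Quantifiers do not affect satisfiability, so the table stays as it is. -/
theorem sweepsTo_bound (w : List Bool) (rest inp : List (Sym S))
    (T : List (List Bool × Finset D)) (v : Reg S) (out : List Bool) (hv : v.second = false) :
    ∃ v' : Reg S, v'.second = false ∧ v'.changed = v.changed ∧ v'.empty = v.empty ∧
      SweepsTo fn v
        ⟨inp, (.exist :: nameWord S w).reverse ++ rest, flatten T, [], [], [], [], out⟩ v'
        ⟨.exist :: nameWord S w ++ inp, rest, flatten T, [], [], [], [], out⟩
        (23 * (flatten T).length + 20 * (w.length + 2)) := by
  obtain ⟨s, hs⟩ := sweepsTo_name (fn := fn) w (.var :: .exist :: rest) v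
    ⟨inp, (.exist :: nameWord S w).reverse ++ rest, flatten T, [], [], [], [], out⟩
    (by simp [nameWord])
  have h := (hs.trans (SweepsTo.head rfl
    (exec_readSym_var_fst T _ _ rfl hv rfl rfl rfl))).trans (SweepsTo.head rfl
    (exec_readSym_exist _ _ rfl))
  refine ⟨_, ?_, ?_, ?_, h.cast ?_ ?_⟩
  · rfl
  · rfl
  · rfl
  · simp [nameWord]
  · simp; omega

/-- From right to left come `y`, `x` and finally `R`, by which time both names and both domains are
at hand. The table is scanned twice, whence `46 = 2 * 23`. -/
theorem sweepsTo_constraint (R : S) (x y : List Bool) (rest inp : List (Sym S))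
    (T : List (List Bool × Finset D)) (v : Reg S) (out : List Bool) (hv : v.second = false) :
    ∃ v' : Reg S, v'.second = false ∧
      v'.changed = (propagate (fn R) x y ⟨T, v.changed, v.empty⟩).changed ∧
      v'.empty = (propagate (fn R) x y ⟨T, v.changed, v.empty⟩).empty ∧
      SweepsTo fn v
        ⟨inp, (.rel R :: (nameWord S x ++ nameWord S y)).reverse ++ rest, flatten T,
          [], [], [], [], out⟩ v'
        ⟨.rel R :: (nameWord S x ++ nameWord S y) ++ inp, rest,
          flatten (propagate (fn R) x y ⟨T, v.changed, v.empty⟩).table, [], [], [], [], out⟩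
        (46 * (flatten T).length + 20 * (x.length + y.length + 3)) := by
  obtain ⟨s, hs⟩ := sweepsTo_name (fn := fn) y
    (.var :: ((x.map .bit).reverse ++ .var :: .rel R :: rest)) v
    ⟨inp, (.rel R :: (nameWord S x ++ nameWord S y)).reverse ++ rest, flatten T,
      [], [], [], [], out⟩ (by simp [nameWord])
  have h1 := hs.trans (SweepsTo.head rfl (exec_readSym_var_fst T _ _ rfl hv rfl rfl rfl))
  obtain ⟨s', h2⟩ := h1.name x (.var :: .rel R :: rest) rfl
  have h := (h2.trans (SweepsTo.head rfl
    (exec_readSym_var_snd T _ _ rfl rfl rfl rfl rfl))).trans (SweepsTo.head rfl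
    (exec_readSym_rel R _ _ rfl rfl))
  refine ⟨_, ?_, ?_, ?_, h.cast ?_ ?_⟩
  · simp [Reg.restrict]
  · simp [propagate, Reg.restrict, support]
  · simp [propagate, Reg.restrict, support]
  · simp [nameWord, propagate, flatten_cons, Reg.restrict, support]
  · simp; omega

end Machine

/-! ### Termination and correctness of arc consistency -/

section Rounds

variable {D : Type} [Fintype D] [DecidableEq D]

theorem mem_domOf {T : List (List Bool × Finset D)} {x : List Bool} {d : D} :
    d ∈ domOf T x ↔ ∀ e ∈ T, e.1 = x → d ∈ e.2 := by
  have h (A : Finset D) : d ∈ T.foldl (fun A e => if e.1 = x then A ∩ e.2 else A) A ↔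
      d ∈ A ∧ ∀ e ∈ T, e.1 = x → d ∈ e.2 := by
    induction T generalizing A with
    | nil => simp
    | cons e T ih =>
      rw [List.foldl_cons, ih, List.forall_mem_cons, ← and_assoc]
      split_ifs with he <;> simp [he]
  rw [domOf, h]
  simp

theorem domOf_anti {T T' : List (List Bool × Finset D)} (h : T ⊆ T') (x : List Bool) :
    domOf T' x ⊆ domOf T x := fun _ hd =>
  mem_domOf.2 fun e he => mem_domOf.1 hd e (h he)

theorem domOf_subset {T : List (List Bool × Finset D)} {x : List Bool} {A : Finset D}
    (h : (x, A) ∈ T) : domOf T x ⊆ A := fun _ hd => mem_domOf.1 hd _ h rfl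

variable {g : D → D} {x y : List Bool} {s : Progress D}

theorem domOf_propagate_subset (z : List Bool) :
    domOf (propagate g x y s).table z ⊆ domOf s.table z :=
  domOf_anti (fun _ h => List.mem_cons_of_mem _ (List.mem_cons_of_mem _ h)) z

theorem image_support_subset (T : List (List Bool × Finset D)) :
    (support g x y T).image g ⊆ domOf T y := by
  intro d hd
  obtain ⟨e, he, rfl⟩ := Finset.mem_image.1 hd
  exact (Finset.mem_filter.1 he).2

/-- The total size of the domains of the variables in `V`. -/
def domSize (V : Finset (List Bool)) (T : List (List Bool × Finset D)) : ℕ :=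
  ∑ z ∈ V, (domOf T z).card

theorem domSize_propagate_le (V : Finset (List Bool)) :
    domSize V (propagate g x y s).table ≤ domSize V s.table :=
  Finset.sum_le_sum fun z _ => Finset.card_le_card (domOf_propagate_subset z)

/-- Both new restrictions are contained in the current domains; one that differs from its domain
removes an element. -/
theorem changed_propagate {V : Finset (List Bool)} (hx : x ∈ V) (hy : y ∈ V)
    (h : (propagate g x y s).changed = true) :
    s.changed = true ∨ domSize V (propagate g x y s).table < domSize V s.table := by
  have key {z : List Bool} {A : Finset D} (hz : z ∈ V)
      (hA : (z, A) ∈ (propagate g x y s).table) (hAs : A ⊆ domOf s.table z)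
      (hne : A ≠ domOf s.table z) :
      domSize V (propagate g x y s).table < domSize V s.table := by
    refine Finset.sum_lt_sum (fun z _ => Finset.card_le_card (domOf_propagate_subset z))
      ⟨z, hz, ?_⟩
    exact (Finset.card_le_card (domOf_subset hA)).trans_lt
      (Finset.card_lt_card (Finset.ssubset_iff_subset_ne.2 ⟨hAs, hne⟩))
  simp only [propagate, Bool.or_eq_true, decide_eq_true_eq] at h
  rcases h with h | h | h
  · exact .inl h
  · exact .inr (key hx List.mem_cons_self (Finset.filter_subset _ _) h)
  · exact .inr (key hy (List.mem_cons_of_mem _ List.mem_cons_self) (image_support_subset _) h)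

/-- The two new entries merely repeat the current domains. -/
theorem propagate_of_not_changed (h : (propagate g x y s).changed = false) :
    s.changed = false ∧ support g x y s.table = domOf s.table x ∧
      (domOf s.table x).image g = domOf s.table y ∧
      domOf (propagate g x y s).table = domOf s.table := by
  simp only [propagate, Bool.or_eq_false_iff, decide_eq_false_iff_not, not_not] at h
  obtain ⟨h1, h2, h3⟩ := h
  refine ⟨h1, h2, by rwa [h2] at h3, ?_⟩
  funext z
  ext d
  rw [mem_domOf, propagate, List.forall_mem_cons, List.forall_mem_cons, ← mem_domOf, h2]
  rw [h2] at h3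
  rw [h3]
  constructor
  · exact fun h => h.2.2
  · exact fun h => ⟨by rintro rfl; exact h, by rintro rfl; exact h, h⟩

variable {R : Type} {fn : R → D → D}

/-- Process the constraints one after the other. A constraint `(R, x, y)` means
`y = fn R x`. -/
def runRound (fn : R → D → D) (cs : List (R × List Bool × List Bool)) (s : Progress D) :
    Progress D :=
  cs.foldr (fun c s => propagate (fn c.1) c.2.1 c.2.2 s) s

/-- Process the constraints once and record whether a domain has changed. -/
def nextRound (fn : R → D → D) (cs : List (R × List Bool × List Bool)) (s : Progress D) :
    Progress D :=
  runRound fn cs { s with changed := false }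

variable {cs : List (R × List Bool × List Bool)}

theorem domSize_runRound_le (V : Finset (List Bool)) :
    domSize V (runRound fn cs s).table ≤ domSize V s.table := by
  induction cs with
  | nil => exact le_rfl
  | cons c cs ih => exact (domSize_propagate_le V).trans ih

theorem changed_runRound {V : Finset (List Bool)} (hV : ∀ c ∈ cs, c.2.1 ∈ V ∧ c.2.2 ∈ V)
    (h : (runRound fn cs s).changed = true) :
    s.changed = true ∨ domSize V (runRound fn cs s).table < domSize V s.table := by
  induction cs with
  | nil => exact .inl h
  | cons c cs ih =>
    have hc := hV c List.mem_cons_self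
    rcases changed_propagate hc.1 hc.2 h with h' | h'
    · exact (ih (fun c hc => hV c (List.mem_cons_of_mem _ hc)) h').imp_right
        (domSize_propagate_le V).trans_lt
    · exact .inr (h'.trans_le (domSize_runRound_le V))

/-- In a round without change the domains stand still, so all constraints were checked against the
same domains, those of `s`. -/
theorem runRound_of_not_changed (h : (runRound fn cs s).changed = false) :
    domOf (runRound fn cs s).table = domOf s.table ∧
      ((runRound fn cs s).empty = false → ∀ c ∈ cs, (domOf s.table c.2.1).Nonempty) ∧
      ∀ c ∈ cs, (domOf s.table c.2.1).image (fn c.1) = domOf s.table c.2.2 := by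
  induction cs with
  | nil => simp [runRound]
  | cons c cs ih =>
    obtain ⟨h1, h2, h3, h4⟩ := propagate_of_not_changed
      (show (propagate (fn c.1) c.2.1 c.2.2 (runRound fn cs s)).changed = false from h)
    obtain ⟨i1, i2, i3⟩ := ih h1
    rw [i1] at h2 h3
    refine ⟨h4.trans i1, fun he => ?_, List.forall_mem_cons.2 ⟨h3, i3⟩⟩
    change ((runRound fn cs s).empty || decide (support (fn c.1) c.2.1 c.2.2
      (runRound fn cs s).table = ∅)) = false at he
    rw [Bool.or_eq_false_iff, decide_eq_false_iff_not, h2] at he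
    exact List.forall_mem_cons.2 ⟨Finset.nonempty_iff_ne_empty.2 he.2, i2 he.1⟩

/-- The state before the first round. -/
def Progress.init (D : Type) : Progress D := ⟨[], true, false⟩

/-- At most `2 * cs.length` variables occur, each with a domain of at most `|D|` points, and every
round that changes something removes a point. The extra round is the one that detects no change. -/
theorem exists_iterate_not_changed (fn : R → D → D) (cs : List (R × List Bool × List Bool)) :
    ∃ r ≤ 2 * Fintype.card D * cs.length + 1,
      ((nextRound fn cs)^[r] (.init D)).changed = false := by
  set V : Finset (List Bool) := (cs.flatMap fun c => [c.2.1, c.2.2]).toFinset with hV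
  have hcs : ∀ c ∈ cs, c.2.1 ∈ V ∧ c.2.2 ∈ V := fun c hc => by
    simp only [hV, List.mem_toFinset, List.mem_flatMap]
    exact ⟨⟨c, hc, by simp⟩, ⟨c, hc, by simp⟩⟩
  have hcard : V.card ≤ 2 * cs.length := by
    refine (List.toFinset_card_le _).trans (le_of_eq ?_)
    simp [List.length_flatMap, mul_comm]
  have h0 : domSize V (Progress.init D).table ≤ 2 * Fintype.card D * cs.length := by
    refine (Finset.sum_le_card_nsmul V _ (Fintype.card D) fun z _ =>
      Finset.card_le_univ _).trans ?_
    rw [smul_eq_mul]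
    nlinarith [Nat.mul_le_mul_right (Fintype.card D) hcard]
  by_contra! H
  have h (r : ℕ) (hr : r ≤ 2 * Fintype.card D * cs.length + 1) :
      r + domSize V ((nextRound fn cs)^[r] (.init D)).table ≤
        domSize V (Progress.init D).table := by
    induction r with
    | zero => simp
    | succ r ih =>
      have h1 := H (r + 1) hr
      have h2 := ih (by omega)
      rw [Function.iterate_succ_apply'] at h1 ⊢
      rcases changed_runRound hcs (by simpa [nextRound] using h1) with h3 | h3
      · simp at h3
      · change domSize V (nextRound fn cs _).table < domSize V (_ : Progress D).table at h3
        dsimp only at h3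
        omega
  have := h _ le_rfl
  omega

/-- The values of a solution `J` support each other, so no restriction removes them. -/
theorem sound_runRound {J : List Bool → D} (hJ : ∀ c ∈ cs, J c.2.2 = fn c.1 (J c.2.1))
    (hs : s.empty = false) (hdom : ∀ z, J z ∈ domOf s.table z) :
    (runRound fn cs s).empty = false ∧ ∀ z, J z ∈ domOf (runRound fn cs s).table z := by
  induction cs with
  | nil => exact ⟨hs, hdom⟩
  | cons c cs ih =>
    obtain ⟨h1, h2⟩ := ih fun c hc => hJ c (List.mem_cons_of_mem _ hc)
    have hc := hJ c List.mem_cons_self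
    have hsup : J c.2.1 ∈ support (fn c.1) c.2.1 c.2.2 (runRound fn cs s).table :=
      Finset.mem_filter.2 ⟨h2 _, hc ▸ h2 _⟩
    refine ⟨?_, fun z => ?_⟩
    · change ((runRound fn cs s).empty || decide (support (fn c.1) c.2.1 c.2.2
        (runRound fn cs s).table = ∅)) = false
      rw [h1, Bool.false_or, decide_eq_false_iff_not]
      exact Finset.ne_empty_of_mem hsup
    · change J z ∈ domOf (propagate (fn c.1) c.2.1 c.2.2 (runRound fn cs s)).table z
      rw [mem_domOf, propagate, List.forall_mem_cons, List.forall_mem_cons, ← mem_domOf]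
      refine ⟨fun e => e ▸ hsup, fun e => ?_, h2 z⟩
      subst e
      rw [hc]
      exact Finset.mem_image_of_mem _ hsup

/-- If the functions commute with an operation on sets, then arc consistency decides whether the
constraints are satisfiable. -/
theorem empty_iterate_eq_false_iff {P : Finset D → D}
    (hP : ∀ r, ∀ A : Finset D, A.Nonempty → P (A.image (fn r)) = fn r (P A)) {r : ℕ}
    (hr : ((nextRound fn cs)^[r] (.init D)).changed = false) :
    ((nextRound fn cs)^[r] (.init D)).empty = false ↔
      ∃ J : List Bool → D, ∀ c ∈ cs, J c.2.2 = fn c.1 (J c.2.1) := by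
  constructor
  · intro he
    cases r with
    -- The flag is initially set, so at least one round was run.
    | zero => cases hr
    | succ r =>
      rw [Function.iterate_succ_apply'] at hr he
      obtain ⟨-, h1, h2⟩ := runRound_of_not_changed hr
      -- For a constraint `y = g x`: `g (P (dom x)) = P (g (dom x)) = P (dom y)`.
      exact ⟨fun z => P (domOf ((nextRound fn cs)^[r] (.init D)).table z), fun c hc => by
        rw [← hP _ _ (h1 he c hc)]
        exact congrArg P (h2 c hc).symm⟩
  · rintro ⟨J, hJ⟩
    suffices h : ((nextRound fn cs)^[r] (.init D)).empty = false ∧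
        ∀ z, J z ∈ domOf ((nextRound fn cs)^[r] (.init D)).table z from h.1
    clear hr
    induction r with
    | zero => exact ⟨rfl, fun z => by simp [mem_domOf, Progress.init]⟩
    | succ r ih =>
      rw [Function.iterate_succ_apply']
      exact sound_runRound hJ ih.1 ih.2

end Rounds

/-! ### Operations that commute with co-Boolean functions -/

/-- If the relation that consists of the rows of values of the functions `f i` is closed under
`min`, and every `f i` maps into `{z, o}` and is monotone there, or is constant, then some operation
on finite sets commutes with all `f i`. -/
theorem exists_commuting_operation {D : Type} [LinearOrder D] {k : ℕ} (f : Fin k → D → D) (z o : D)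
    (hf : ∀ i, (∀ d, f i d ∈ ({z, o} : Set D)) ∧ MonotoneOn (f i) {z, o} ∨ IsConstant (f i))
    (hclosed : ClosedUnder min (properHNormalForm f)) :
    ∃ P : Finset D → D, ∀ i, ∀ A : Finset D, A.Nonempty → P (A.image (f i)) = f i (P A) := by
  have hinf (A : Finset D) (hA : A.Nonempty) : ∃ d, ∀ i, f i d = A.inf' hA (f i) := by
    induction hA using Finset.Nonempty.cons_induction with
    | singleton a => exact ⟨a, fun i => by simp⟩
    | cons a A ha hA ih =>
      obtain ⟨d, hd⟩ := ih
      obtain ⟨e, he⟩ := hclosed _ ⟨a, rfl⟩ _ ⟨d, rfl⟩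
      exact ⟨e, fun i => by rw [Finset.inf'_cons hA, ← hd, ← congrFun he i]⟩
  -- On the sets that can be images under some `f i`, the witness is forced to be the minimum of the
  -- set; monotonicity on `{z, o}` makes its row the minimum of the rows.
  have hop (A : Finset D) (hA : A.Nonempty) : ∃ d, (∀ i, f i d = A.inf' hA (f i)) ∧
      (((A : Set D) ⊆ {z, o} ∨ ∃ c, A = {c}) → d = A.min' hA) := by
    by_cases h : (A : Set D) ⊆ {z, o} ∨ ∃ c, A = {c}
    · refine ⟨A.min' hA, fun i => ?_, fun _ => rfl⟩
      refine le_antisymm (Finset.le_inf' _ _ fun a ha => ?_)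
        (Finset.inf'_le _ (Finset.min'_mem A hA))
      rcases h with h | ⟨c, rfl⟩
      · rcases hf i with ⟨-, hm⟩ | ⟨c, hc⟩
        · exact hm (h (Finset.min'_mem A hA)) (h ha) (Finset.min'_le _ _ ha)
        · rw [hc, hc]
      · rw [Finset.mem_singleton.1 ha, Finset.min'_singleton]
    · exact (hinf A hA).imp fun d hd => ⟨hd, fun h' => absurd h' h⟩
  choose Q hQ hQ' using hop
  refine ⟨fun A => if h : A.Nonempty then Q A h else z, fun i A hA => ?_⟩
  simp only
  rw [dif_pos hA, dif_pos (hA.image _), hQ, hQ']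
  · rw [Finset.min'_eq_inf', Finset.inf'_image]
    rfl
  · rcases hf i with ⟨hr, -⟩ | ⟨c, hc⟩
    · left
      intro d hd
      obtain ⟨e, -, rfl⟩ := Finset.mem_image.1 (Finset.mem_coe.1 hd)
      exact hr e
    · right
      refine ⟨c, ?_⟩
      rw [Finset.image_congr (g := fun _ => c) fun x _ => hc x, Finset.image_const hA]

/-! ### Running time of the whole program -/

section Machine

variable {D : Type} [Fintype D] [DecidableEq D] {S : Set (FinRel D)} {fn : S → D → D}

local infixr:60 " ⨟ " => Prog.seq

/-- The code of a list of quantified variables. -/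
def boundWord (S : Set (FinRel D)) (bs : List (List Bool)) : List (Sym S) :=
  bs.flatMap fun b => .exist :: nameWord S b

/-- The code of a list of constraints. -/
def constraintWord (cs : List (S × List Bool × List Bool)) : List (Sym S) :=
  cs.flatMap fun c => .rel c.1 :: (nameWord S c.2.1 ++ nameWord S c.2.2)

/-- A constraint adds its two names and two restrictions to the table, one symbol less than the
length of its own code. -/
theorem length_flatten_runRound (cs : List (S × List Bool × List Bool)) (s : Progress D) :
    (flatten (runRound fn cs s).table).length + cs.length =
      (flatten s.table).length + (constraintWord cs).length := by
  induction cs with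
  | nil => rfl
  | cons c cs ih =>
    have h : (flatten (runRound fn (c :: cs) s).table).length =
        c.2.1.length + c.2.2.length + 2 + (flatten (runRound fn cs s).table).length := by
      change (flatten (propagate (fn c.1) c.2.1 c.2.2 (runRound fn cs s)).table).length = _
      simp [propagate, flatten_cons]; omega
    rw [h]
    simp [constraintWord, nameWord] at ih ⊢
    omega

omit [Fintype D] [DecidableEq D] in
theorem length_le_length_constraintWord (cs : List (S × List Bool × List Bool)) :
    cs.length ≤ (constraintWord cs).length := by
  induction cs with
  | nil => rfl
  | cons c cs ih => simp [constraintWord] at ih ⊢; omega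

theorem runRound_append (cs cs' : List (S × List Bool × List Bool)) (s : Progress D) :
    runRound fn (cs ++ cs') s = runRound fn cs (runRound fn cs' s) :=
  List.foldr_append

/-- The induction removes the last constraint, which is read first. The table only grows, so a bound
`B` on its final length serves throughout. -/
theorem sweepsTo_constraints (cs : List (S × List Bool × List Bool)) (s : Progress D)
    (rest inp : List (Sym S)) (v : Reg S) (out : List Bool) (B : ℕ) (hv : v.second = false)
    (hc : v.changed = s.changed) (he : v.empty = s.empty)
    (hB : (flatten (runRound fn cs s).table).length ≤ B) :
    ∃ v' : Reg S, v'.second = false ∧ v'.changed = (runRound fn cs s).changed ∧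
      v'.empty = (runRound fn cs s).empty ∧
      SweepsTo fn v ⟨inp, (constraintWord cs).reverse ++ rest, flatten s.table, [], [], [], [], out⟩
        v' ⟨constraintWord cs ++ inp, rest, flatten (runRound fn cs s).table, [], [], [], [], out⟩
        ((46 * B + 20) * (constraintWord cs).length) := by
  induction cs using List.reverseRecOn generalizing s v inp with
  | nil => exact ⟨v, hv, hc, he, fun _ _ _ h => h.mono (by simp)⟩
  | append_singleton cs c ih =>
    rw [runRound_append] at hB ⊢
    have hs : runRound fn [c] s = propagate (fn c.1) c.2.1 c.2.2 ⟨s.table, v.changed, v.empty⟩ := by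
      rw [hc, he]; rfl
    obtain ⟨v₁, h1, h2, h3, h4⟩ := sweepsTo_constraint (fn := fn) c.1 c.2.1 c.2.2
      ((constraintWord cs).reverse ++ rest) inp s.table v out hv
    rw [← hs] at h2 h3 h4
    obtain ⟨v₂, i1, i2, i3, i4⟩ := ih (runRound fn [c] s)
      (.rel c.1 :: (nameWord S c.2.1 ++ nameWord S c.2.2) ++ inp) v₁ h1 h2 h3 hB
    have hB' : (flatten s.table).length ≤ B := by
      have j1 := length_flatten_runRound (fn := fn) cs (runRound fn [c] s)
      have j2 := length_flatten_runRound (fn := fn) [c] s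
      have j3 := length_le_length_constraintWord cs
      have j4 := length_le_length_constraintWord [c]
      omega
    refine ⟨v₂, i1, i2, i3, ?_⟩
    convert (h4.trans i4).mono ?_ using 1
    · simp [constraintWord]
    · simp [constraintWord]
    · have : (constraintWord (cs ++ [c])).length =
          (constraintWord cs).length + (c.2.1.length + c.2.2.length + 3) := by
        simp [constraintWord, nameWord]; omega
      rw [this]
      nlinarith [Nat.mul_le_mul_left 46 hB']

theorem sweepsTo_bounds (bs : List (List Bool)) (T : List (List Bool × Finset D))
    (rest inp : List (Sym S)) (v : Reg S) (out : List Bool) (B : ℕ) (hv : v.second = false)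
    (hB : (flatten T).length ≤ B) :
    ∃ v' : Reg S, v'.second = false ∧ v'.changed = v.changed ∧ v'.empty = v.empty ∧
      SweepsTo fn v ⟨inp, (boundWord S bs).reverse ++ rest, flatten T, [], [], [], [], out⟩
        v' ⟨boundWord S bs ++ inp, rest, flatten T, [], [], [], [], out⟩
        ((46 * B + 20) * (boundWord S bs).length) := by
  induction bs using List.reverseRecOn generalizing v inp with
  | nil => exact ⟨v, hv, rfl, rfl, fun _ _ _ h => h.mono (by simp)⟩
  | append_singleton bs b ih =>
    obtain ⟨v₁, h1, h2, h3, h4⟩ := sweepsTo_bound (fn := fn) b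
      ((boundWord S bs).reverse ++ rest) inp T v out hv
    obtain ⟨v₂, i1, i2, i3, i4⟩ := ih (.exist :: nameWord S b ++ inp) v₁ h1
    refine ⟨v₂, i1, i2.trans h2, i3.trans h3, ?_⟩
    convert (h4.trans i4).mono ?_ using 1
    · simp [boundWord]
    · simp [boundWord]
    · have : (boundWord S (bs ++ [b])).length = (boundWord S bs).length + (b.length + 2) := by
        simp [boundWord, nameWord]
      rw [this]
      nlinarith [Nat.mul_le_mul_left 23 hB]

theorem exec_sweep (bs : List (List Bool)) (cs : List (S × List Bool × List Bool))
    (s : Progress D) (v : Reg S) (out : List Bool) (B : ℕ) (hv : v.second = false)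
    (hc : v.changed = s.changed) (he : v.empty = s.empty)
    (hB : (flatten (runRound fn cs s).table).length ≤ B) :
    ∃ v' : Reg S, v'.second = false ∧ v'.changed = (runRound fn cs s).changed ∧
      v'.empty = (runRound fn cs s).empty ∧
      Exec (sweep fn) v
        ⟨[], (boundWord S bs ++ constraintWord cs).reverse, flatten s.table, [], [], [], [], out⟩ v'
        ⟨boundWord S bs ++ constraintWord cs, [], flatten (runRound fn cs s).table,
          [], [], [], [], out⟩
        ((46 * B + 20) * (boundWord S bs ++ constraintWord cs).length + 2) := by
  obtain ⟨v₁, h1, h2, h3, h4⟩ := sweepsTo_constraints cs s (boundWord S bs).reverse [] v out B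
    hv hc he hB
  obtain ⟨v₂, i1, i2, i3, i4⟩ := sweepsTo_bounds (fn := fn) bs (runRound fn cs s).table []
    (constraintWord cs) v₁ out B h1 hB
  refine ⟨v₂.setSym none, i1, i2.trans h2, i3.trans h3, ?_⟩
  rw [List.append_nil] at h4 i4
  rw [List.reverse_append]
  refine ((h4.trans i4) _ _ _ (exec_forEach_nil (k := .cons) (set := Reg.setSym)
    (get := Reg.sym) (fun _ _ => rfl) rfl)).mono (le_of_eq ?_)
  rw [List.length_append]
  ring

/-- The initial state of the program. -/
def Reg.init (S : Set (FinRel D)) : Reg S := ⟨none, none, none, true, ∅, ∅, false, true, false⟩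

/-- One round of the main loop. -/
def round (fn : S → D → D) : Prog (Alphabet S) (Reg S) :=
  .load (fun v => { v with changed := false }) ⨟
  .forEach .inp Reg.setSym Reg.sym (.push .cons (fun v => v.sym.getD .var)) ⨟
  sweep fn

/-- The program that decides satisfiability. -/
def decideSat (fn : S → D → D) : Prog (Alphabet S) (Reg S) :=
  .loop Reg.changed (round fn) ⨟
  -- `Turing.haltList` demands empty stacks apart from the output, and the initial internal state.
  .forEach .inp Reg.setSym Reg.sym (.load id) ⨟
  .forEach .tab Reg.setEnt Reg.ent (.load id) ⨟
  .push .out (fun v => !v.empty) ⨟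
  .load (fun _ => .init S)

theorem exec_round (bs : List (List Bool)) (cs : List (S × List Bool × List Bool))
    (s : Progress D) (v : Reg S) (out : List Bool) (B : ℕ) (hv : v.second = false)
    (he : v.empty = s.empty)
    (hB : (flatten (nextRound fn cs s).table).length ≤ B) :
    ∃ v' : Reg S, v'.second = false ∧ v'.changed = (nextRound fn cs s).changed ∧
      v'.empty = (nextRound fn cs s).empty ∧
      Exec (round fn) v
        ⟨boundWord S bs ++ constraintWord cs, [], flatten s.table, [], [], [], [], out⟩ v'
        ⟨boundWord S bs ++ constraintWord cs, [], flatten (nextRound fn cs s).table,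
          [], [], [], [], out⟩
        ((46 * B + 23) * (boundWord S bs ++ constraintWord cs).length + 5) := by
  obtain ⟨v₁, h1, h2, h3, h4⟩ := exec_sweep bs cs { s with changed := false }
    { v with sym := none, changed := false } out B hv rfl he hB
  refine ⟨v₁, h1, h2, h3, ?_⟩
  refine Exec.mono ((exec_load _).seq ((exec_pour_inp_cons _ _).seq ?_))
    (s := 1 + (3 * (boundWord S bs ++ constraintWord cs).length + 2 +
      ((46 * B + 20) * (boundWord S bs ++ constraintWord cs).length + 2))) (le_of_eq (by ring))
  simpa [nextRound] using h4

/-- The loop may stop at an earlier round `r'`; the given `r` only bounds the time. -/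
theorem exec_rounds (bs : List (List Bool)) (cs : List (S × List Bool × List Bool))
    (s : Progress D) (v : Reg S) (out : List Bool) (B : ℕ) (hv : v.second = false)
    (hc : v.changed = s.changed) (he : v.empty = s.empty) (r : ℕ)
    (hr : ((nextRound fn cs)^[r] s).changed = false)
    (hB : ∀ j ≤ r, (flatten ((nextRound fn cs)^[j] s).table).length ≤ B) :
    ∃ r' ≤ r, ((nextRound fn cs)^[r'] s).changed = false ∧ ∃ v' : Reg S,
      v'.empty = ((nextRound fn cs)^[r'] s).empty ∧
      Exec (.loop Reg.changed (round fn)) v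
        ⟨boundWord S bs ++ constraintWord cs, [], flatten s.table, [], [], [], [], out⟩ v'
        ⟨boundWord S bs ++ constraintWord cs, [],
          flatten ((nextRound fn cs)^[r'] s).table, [], [], [], [], out⟩
        (r * ((46 * B + 23) * (boundWord S bs ++ constraintWord cs).length + 6) + 1) := by
  induction r generalizing s v with
  | zero =>
    exact ⟨0, le_rfl, hr, v, he, (exec_loop_false (hc.trans hr)).mono (by simp)⟩
  | succ r ih =>
    cases h : s.changed with
    | false => exact ⟨0, Nat.zero_le _, h, v, he, (exec_loop_false (hc.trans h)).mono (by simp)⟩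
    | true =>
      obtain ⟨v₁, h1, h2, h3, h4⟩ := exec_round bs cs s v out B hv he
        (hB 1 (by omega))
      obtain ⟨r', i1, i2, v₂, i3, i4⟩ := ih (nextRound fn cs s) v₁ h1 h2 h3 hr
        fun j hj => hB (j + 1) (by omega)
      exact ⟨r' + 1, by omega, i2, v₂, i3,
        (Exec.loop_true (hc.trans h) h4 i4).mono (le_of_eq (by ring))⟩

theorem length_flatten_iterate_le (cs : List (S × List Bool × List Bool)) (j : ℕ) :
    (flatten ((nextRound fn cs)^[j] (.init D)).table).length ≤ j * (constraintWord cs).length := by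
  induction j with
  | zero => simp [flatten, Progress.init]
  | succ j ih =>
    rw [Function.iterate_succ_apply']
    have h := length_flatten_runRound (fn := fn) cs
      { (nextRound fn cs)^[j] (.init D) with changed := false }
    dsimp only at h
    rw [nextRound]
    rw [add_mul, one_mul]
    omega

/-- `N` bounds the number of rounds and `N * L` the length of the table. -/
theorem exec_decideSat {P : Finset D → D}
    (hP : ∀ r, ∀ A : Finset D, A.Nonempty → P (A.image (fn r)) = fn r (P A))
    (bs : List (List Bool)) (cs : List (S × List Bool × List Bool)) {L N : ℕ}
    (hL : (boundWord S bs ++ constraintWord cs).length = L)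
    (hN : N = 2 * Fintype.card D * L + 1) (b : Bool)
    (hb : b = true ↔ ∃ J : List Bool → D, ∀ c ∈ cs, J c.2.2 = fn c.1 (J c.2.1)) :
    Exec (decideSat fn) (.init S)
      ⟨boundWord S bs ++ constraintWord cs, [], [], [], [], [], [], []⟩ (.init S)
      ⟨[], [], [], [], [], [], [], [b]⟩
      (N * ((46 * (N * L) + 23) * L + 6) + 3 * L + 3 * (N * L) + 7) := by
  obtain ⟨r, hr, hr'⟩ := exists_iterate_not_changed fn cs
  have hcs := length_le_length_constraintWord cs
  have hcL : (constraintWord cs).length ≤ L := by rw [← hL, List.length_append]; omega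
  have hrN : r ≤ N := by
    rw [hN]
    exact hr.trans (Nat.add_le_add_right (Nat.mul_le_mul_left _ (hcs.trans hcL)) 1)
  have hB (j : ℕ) (hj : j ≤ r) :
      (flatten ((nextRound fn cs)^[j] (.init D)).table).length ≤ N * L :=
    (length_flatten_iterate_le cs j).trans (Nat.mul_le_mul (hj.trans hrN) hcL)
  obtain ⟨r', h1, h2, v, h3, h4⟩ := exec_rounds bs cs (.init D) (.init S) [] (N * L) rfl rfl rfl
    r hr' hB
  rw [hL] at h4
  have hv : (!v.empty) = b := by
    rw [h3, Bool.eq_iff_iff, hb, Bool.not_eq_true', empty_iterate_eq_false_iff hP h2]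
  subst hv
  refine Exec.mono (h4.seq <| (exec_forEach_load_id (k := .inp) (set := Reg.setSym)
    (get := Reg.sym) (fun _ _ => rfl) (fun _ _ _ => rfl) _ _).seq <|
    (exec_forEach_load_id (k := .tab) (set := Reg.setEnt) (get := Reg.ent) (fun _ _ => rfl)
    (fun _ _ _ => rfl) _ _).seq <| (exec_push _ _).seq <|
    exec_load _) ?_
  · have h5 := hB r' h1
    have h6 := Nat.mul_le_mul_right ((46 * (N * L) + 23) * L + 6) hrN
    change _ + (3 * (boundWord S bs ++ constraintWord cs).length + 2 +
      (3 * (flatten ((nextRound fn cs)^[r'] (.init D)).table).length + 2 + (1 + 1))) ≤ _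
    rw [hL]
    omega

end Machine

/-! ### From the program to a machine for `CSPInP` -/

section Templates

variable {D : Type}

theorem finite_sym {S : Set (FinRel D)} (hS : S.Finite) : Finite (Sym S) := by
  have := hS.to_subtype
  refine Finite.of_surjective (α := Option (Option (S ⊕ Bool))) (fun a => match a with
    | none => .exist
    | some none => .var
    | some (some (.inl R)) => .rel R
    | some (some (.inr b)) => .bit b) fun a => ?_
  cases a with
  | exist => exact ⟨none, rfl⟩
  | var => exact ⟨some none, rfl⟩
  | rel R => exact ⟨some (some (.inl R)), rfl⟩
  | bit b => exact ⟨some (some (.inr b)), rfl⟩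

theorem finite_reg [Finite D] {S : Set (FinRel D)} (hS : S.Finite) : Finite (Reg S) := by
  have := finite_sym hS
  refine Finite.of_injective (fun v : Reg S => (v.sym, v.ent, v.bit, v.eq, v.acc, v.dom, v.second,
    v.changed, v.empty)) fun v w h => ?_
  cases v
  cases w
  simpa using h

/-- A constraint over graphs of functions, with its code and its meaning. -/
theorem Constraint.exists_args {S : Set (FinRel D)} {fn : S → D → D}
    (hfn : ∀ R, graph (fn R) = R.1) (c : Constraint S) :
    ∃ x y : ℕ, c.encode = .rel c.rel :: (nameWord S x.bits ++ nameWord S y.bits) ∧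
      ∀ I : ℕ → D, c.Holds I ↔ I y = fn c.rel (I x) := by
  obtain ⟨⟨R, hR⟩, args⟩ := c
  have h := hfn ⟨R, hR⟩
  unfold Constraint.Holds Constraint.encode
  dsimp only at h args ⊢
  -- Since `fn ⟨R, hR⟩` itself mentions `R`, it has to become a variable before `R` can be replaced
  -- by a graph.
  generalize fn ⟨R, hR⟩ = g at h ⊢
  subst h
  refine ⟨args (0 : Fin 2), args (1 : Fin 2), ?_, fun I => ?_⟩
  · have h : List.ofFn args = [args (0 : Fin 2), args (1 : Fin 2)] := List.ofFn_succ
    rw [h]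
    simp [encodeVar, nameWord]
  · constructor
    · rintro ⟨d, hd⟩
      have h0 : I (args (0 : Fin 2)) = d := congrFun hd (0 : Fin 2)
      have h1 : I (args (1 : Fin 2)) = g d := congrFun hd (1 : Fin 2)
      rw [h1, h0]
    · intro h
      refine ⟨I (args (0 : Fin 2)), ?_⟩
      rw [← h]
      funext i
      change Fin 2 at i
      match i with
      | 0 => rfl
      | 1 => rfl

variable [Fintype D] [DecidableEq D]

/-- The stack machine that runs the program. -/
noncomputable def machine {S : Set (FinRel D)} (hS : S.Finite) (fn : S → D → D) :
    Turing.FinTM2 :=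
  have := finite_sym hS
  have := finite_reg hS
  have := (decideSat fn).finite_label
  { K := Stack
    k₀ := .inp
    k₁ := .out
    Γ := Alphabet S
    Λ := (decideSat fn).Label
    main := (decideSat fn).start
    ΛFin := Fintype.ofFinite _
    σ := Reg S
    initialState := .init S
    σFin := Fintype.ofFinite _
    Γk₀Fin := show Fintype (Sym S) from Fintype.ofFinite _
    m := (decideSat fn).code id .halt }

theorem initList_machine {S : Set (FinRel D)} (hS : S.Finite) (fn : S → D → D)
    (w : List (Sym S)) :
    Turing.initList (machine hS fn) w =
      ⟨some (decideSat fn).start, .init S, (⟨w, [], [], [], [], [], [], []⟩ : Mem S).stk⟩ := by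
  refine congrArg (Turing.TM2.Cfg.mk _ _) ?_
  funext k
  cases k <;> rfl

theorem haltList_machine {S : Set (FinRel D)} (hS : S.Finite) (fn : S → D → D)
    (w : List Bool) :
    Turing.haltList (machine hS fn) w =
      ⟨none, .init S, (⟨[], [], [], [], [], [], [], w⟩ : Mem S).stk⟩ := by
  refine congrArg (Turing.TM2.Cfg.mk _ _) ?_
  funext k
  cases k <;> rfl

theorem cspInP_graphs {F : Set (D → D)} (hF : F.Finite) {P : Finset D → D}
    (hP : ∀ g ∈ F, ∀ A : Finset D, A.Nonempty → P (A.image g) = g (P A)) :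
    CSPInP (graphs F) := by
  set S := graphs F
  have hS : S.Finite := hF.image _
  choose fn hfnF hfn using fun R : S => R.2
  choose X Y hXY hI using Constraint.exists_args (S := S) hfn
  have hbits : Function.Injective Nat.bits := fun x y h =>
    Nat.eq_of_testBit_eq fun i => by rw [Nat.testBit_eq_inth, Nat.testBit_eq_inth, h]
  classical
  let N : Polynomial ℕ := Polynomial.C (2 * Fintype.card D) * Polynomial.X + 1
  let time : Polynomial ℕ := N * ((46 * (N * Polynomial.X) + 23) * Polynomial.X + 6) +
    3 * Polynomial.X + 3 * (N * Polynomial.X) + 7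
  suffices h : ∀ φ : Formula S, Nonempty (Turing.TM2OutputsInTime (machine hS fn)
      (φ.encode.map id) (some ([decide φ.Satisfiable].map id)) (time.eval φ.encode.length)) from
    ⟨⟨⟨machine hS fn, Equiv.refl (Sym S), Equiv.refl Bool⟩, time, fun φ => (h φ).some⟩⟩
  intro φ
  let cs : List (S × List Bool × List Bool) :=
    φ.constraints.map fun c => (c.rel, (X c).bits, (Y c).bits)
  have henc : φ.encode = boundWord S (φ.bound.map Nat.bits) ++ constraintWord cs := by
    simp only [Formula.encode, boundWord, constraintWord, cs, List.flatMap_map, ← hXY]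
    rfl
  have hsat : φ.Satisfiable ↔ ∃ J : List Bool → D, ∀ c ∈ cs, J c.2.2 = fn c.1 (J c.2.1) := by
    constructor
    · rintro ⟨I, hφ⟩
      -- The program works with names as words; words that are not the code of a number do not occur
      -- in `cs`, so their values are irrelevant.
      refine ⟨fun w => I (Function.invFun Nat.bits w), fun c hc => ?_⟩
      obtain ⟨c', hc', rfl⟩ := List.mem_map.1 hc
      simpa only [Function.leftInverse_invFun hbits _] using (hI c' I).1 (hφ c' hc')
    · rintro ⟨J, hJ⟩
      exact ⟨fun n => J n.bits, fun c hc =>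
        (hI c _).2 (hJ _ (List.mem_map.2 ⟨c, hc, rfl⟩))⟩
  obtain ⟨t, ht, hrun⟩ := exec_decideSat (fn := fn) (fun R => hP _ (hfnF R))
    (φ.bound.map Nat.bits) cs (congrArg List.length henc.symm) rfl _
    (decide_eq_true_iff.trans hsat)
  refine ⟨⟨⟨t, ?_⟩, ?_⟩⟩
  · have h := hrun.iterate_step ((decideSat fn).code id .halt) id .halt fun _ => rfl
    rw [← henc] at h
    have h1 := (congrArg (Turing.initList (machine hS fn)) (List.map_id φ.encode)).trans
      (initList_machine hS fn φ.encode)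
    have h2 := (congrArg (Turing.haltList (machine hS fn)) (List.map_id [decide φ.Satisfiable])).trans
      (haltList_machine hS fn [decide φ.Satisfiable])
    exact (congrArg (fun c => (flip bind (machine hS fn).step)^[t] (some c)) h1).trans
      (h.trans (congrArg some h2.symm))
  · simpa [time, N] using ht

end Templates

end CoBooleanCSP

theorem mainTheorem3 (n k : ℕ) (f : Fin k → Fin (n + 2) → Fin (n + 2))
    (hf : ∀ i, CoBooleanCSP.IsCoBoolean (f i) ∨ CoBooleanCSP.IsConstant (f i))
    (hclosed : CoBooleanCSP.ClosedUnder min (CoBooleanCSP.properHNormalForm f) ∨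
      CoBooleanCSP.ClosedUnder max (CoBooleanCSP.properHNormalForm f))
    (a b : Fin k → Fin (n + 2))
    (ha : Fin.cons 0 a ∈ CoBooleanCSP.hNormalForm f)
    (hb : Fin.cons 1 b ∈ CoBooleanCSP.hNormalForm f)
    (hab : a ≤ b) :
    CoBooleanCSP.CSPInP (CoBooleanCSP.graphs (Set.range f)) := by
  have hle (i : Fin k) : f i 0 ≤ f i 1 := by
    obtain ⟨d, hd⟩ := ha
    obtain ⟨e, he⟩ := hb
    obtain ⟨rfl, rfl⟩ := Fin.cons_inj.1 hd
    obtain ⟨rfl, rfl⟩ := Fin.cons_inj.1 he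
    exact hab i
  have hf' (i : Fin k) : (∀ d, f i d ∈ ({0, 1} : Set (Fin (n + 2)))) ∧
      MonotoneOn (f i) {0, 1} ∨ CoBooleanCSP.IsConstant (f i) := by
    refine (hf i).imp_left fun h => ⟨fun d => (h : Set.range (f i) = {0, 1}) ▸ Set.mem_range_self d, ?_⟩
    rintro x (rfl | rfl) y (rfl | rfl) hxy
    · exact le_rfl
    · exact hle i
    · exact absurd hxy (by simp)
    · exact le_rfl
  obtain ⟨P, hP⟩ : ∃ P : Finset (Fin (n + 2)) → Fin (n + 2), ∀ i, ∀ A : Finset (Fin (n + 2)),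
      A.Nonempty → P (A.image (f i)) = f i (P A) := by
    rcases hclosed with h | h
    · exact CoBooleanCSP.exists_commuting_operation f 0 1 hf' h
    -- In the dual order `max` is `min`, and monotonicity on `{0, 1}` is preserved; the lemma does
    -- not ask which of `z` and `o` is smaller.
    · exact CoBooleanCSP.exists_commuting_operation (D := (Fin (n + 2))ᵒᵈ) f 0 1
        (fun i => (hf' i).imp_left fun h => ⟨h.1, h.2.dual⟩) h
  refine CoBooleanCSP.cspInP_graphs (Set.finite_range f) (P := P) ?_
  rintro _ ⟨i, rfl⟩
  exact hP i
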